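/- Let $(\Omega,\mathcal F,\mathbb P)$ be a probability space with a filtration $(\mathcal F_t)_{t\ge 0}$, and let $(W_t)_{t\ge 0}$ be a standard real Brownian motion relative to $(\mathcal F_t)$, i.e. $W$ is adapted, $W_t-W_s$ is independent of $\mathcal F_s$ for $0\le s\le t$, and almost all paths of $W$ are continuous. Let $0\le a<b<\infty$, let $\Phi\in C^1(\mathbb R,\mathbb R)$, and put $\lambda=255/512$. For a partition $\Delta=\{a=t_0<t_1<\dots<t_n=b\}$ of $[a,b]$ write $\|\Delta\|=\max_{1\le j\le n}(t_j-t_{j-1})$ and $t_j^*=\lambda t_j+(1-\lambda)t_{j-1}$. Then the limit in probability $$\int_a^b\Phi(W_t)\star\mathrm dW_t:=\lim_{\|\Delta\|\to0}\sum_{j=1}^n\Phi(W_{t_j^*})\,(W_{t_j}-W_{t_{j-1}})$$ (the Fehlberg $255/512$-integral) exists. Moreover the Itô integral $\int_a^b\Phi(W_t)\,\mathrm dW_t$ exists, $\int_a^b\Phi'(W_t)\,\mathrm dt$ is almost surely well defined, and $$\int_a^b\Phi(W_t)\star\mathrm dW_t=\int_a^b\Phi(W_t)\,\mathrm dW_t+\frac{255}{512}\int_a^b\Phi'(W_t)\,\mathrm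 dt\qquad\text{almost surely.}$$ Here the Itô integral of an adapted process $f$ whose paths are almost surely measurable with $\int_a^b|f_t|^2\,\mathrm dt<\infty$ is the limit in probability of $\sum_j\xi_j^{(n)}\bigl(W_{t_j^{(n)}}-W_{t_{j-1}^{(n)}}\bigr)$ along any sequence of simple processes $H^{(n)}=\sum_j\xi_j^{(n)}\mathbf 1_{(t_{j-1}^{(n)},t_j^{(n)}]}$, with $\xi_j^{(n)}$ bounded and $\mathcal F_{t_{j-1}^{(n)}}$-measurable, such that $\int_a^b|H^{(n)}_t-f_t|^2\,\mathrm dt\to0$ in probability. -/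

import Mathlib

open MeasureTheory ProbabilityTheory Filter Topology
open scoped NNReal ENNReal

noncomputable section

/-- A partition `a = t_0 < t_1 < ... < t_n = b` of the time interval `[a, b]`. -/
structure TimePartition (a b : ℝ≥0) where
  /-- the number of subintervals -/
  n : ℕ
  /-- the partition points -/
  pt : Fin (n + 1) → ℝ≥0
  strictMono : StrictMono pt
  first : pt 0 = a
  last : pt (Fin.last n) = b

namespace TimePartition

variable {a b : ℝ≥0}

/-- The diameter of the partition, `max_j (t_j - t_{j-1})`. -/
def diam (π : TimePartition a b) : ℝ≥0 :=
  Finset.univ.sup fun j : Fin π.n => π.pt j.succ - π.pt j.castSucc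

/-- The filter describing the limit "as the diameter of the partition tends to zero", over all
partitions of `[a, b]`. -/
def diamToZero (a b : ℝ≥0) : Filter (TimePartition a b) :=
  comap diam (𝓝 0)

/-- The evaluation point `λ t_j + (1 - λ) t_{j-1}`, with `λ = 255/512`, of the subinterval
`[t_{j-1}, t_j]`. -/
def fehlbergPt (π : TimePartition a b) (j : Fin π.n) : ℝ≥0 :=
  (255 / 512) * π.pt j.succ + (1 - 255 / 512) * π.pt j.castSucc

end TimePartition

variable {Ω : Type*} {mΩ : MeasurableSpace Ω}

/-- `W` is a standard real Brownian motion relative to the filtration `𝓕`: it is a Brownian motion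
(with almost surely continuous paths), it is adapted to `𝓕`, and its increments after time `s` are
independent of `𝓕 s`. -/
structure IsFilteredBrownian (W : ℝ≥0 → Ω → ℝ) (𝓕 : Filtration ℝ≥0 mΩ) (P : Measure Ω) :
    Prop where
  isBrownian : IsBrownianReal W P
  adapted : StronglyAdapted 𝓕 W
  indep : ∀ s t : ℝ≥0, s ≤ t →
    Indep (MeasurableSpace.comap (fun ω => W t ω - W s ω) inferInstance) (𝓕 s) P

/-- The Riemann sum `∑_j Φ(W_{t_j^*}) (W_{t_j} - W_{t_{j-1}})`,
where `t_j^* = λ t_j + (1 - λ) t_{j-1}` and `λ = 255/512`. -/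
def fehlbergSum (W : ℝ≥0 → Ω → ℝ) (Φ : ℝ → ℝ) {a b : ℝ≥0} (π : TimePartition a b) (ω : Ω) : ℝ :=
  ∑ j : Fin π.n,
    Φ (W (π.fehlbergPt j) ω) * (W (π.pt j.succ) ω - W (π.pt j.castSucc) ω)

/-- `S` is (a version of) the Fehlberg `255/512`-integral of `Φ(W)` over `[a, b]` with respect to
`W`: the limit in probability of the Riemann sums as the diameter of the partition tends to zero. -/
def IsFehlbergIntegral (P : Measure Ω) (W : ℝ≥0 → Ω → ℝ) (Φ : ℝ → ℝ) (a b : ℝ≥0) (S : Ω → ℝ) :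
    Prop :=
  AEMeasurable S P ∧
    TendstoInMeasure P (fun π : TimePartition a b => fehlbergSum W Φ π)
      (TimePartition.diamToZero a b) S

/-- A simple process `∑_j ξ_j 1_{(t_{j-1}, t_j]}` on `[a, b]`, with `ξ_j` bounded and
measurable with respect to `𝓕 t_{j-1}`. -/
structure ItoSimpleProcess (𝓕 : Filtration ℝ≥0 mΩ) (a b : ℝ≥0) extends TimePartition a b where
  /-- the random value on each subinterval -/
  ξ : Fin n → Ω → ℝ
  measurable_ξ : ∀ j, Measurable[𝓕 (pt j.castSucc)] (ξ j)
  bounded_ξ : ∀ j, ∃ C : ℝ, ∀ ω, |ξ j ω| ≤ C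

namespace ItoSimpleProcess

variable {𝓕 : Filtration ℝ≥0 mΩ} {a b : ℝ≥0}

/-- The value of the simple process at time `t`. -/
def val (H : ItoSimpleProcess 𝓕 a b) (t : ℝ≥0) (ω : Ω) : ℝ :=
  ∑ j : Fin H.n, (Set.Ioc (H.pt j.castSucc) (H.pt j.succ)).indicator (fun _ => H.ξ j ω) t

/-- The stochastic integral `∑_j ξ_j (W_{t_j} - W_{t_{j-1}})` of a simple process. -/
def integral (H : ItoSimpleProcess 𝓕 a b) (W : ℝ≥0 → Ω → ℝ) (ω : Ω) : ℝ :=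
  ∑ j : Fin H.n, H.ξ j ω * (W (H.pt j.succ) ω - W (H.pt j.castSucc) ω)

end ItoSimpleProcess

/-- `I` is (a version of) the Itô integral `∫_a^b f_t dW_t`. The integrand `f` is adapted to `𝓕`,
almost all of its paths are measurable with `∫_a^b |f_t|² dt < ∞`, and `I` is the limit in
probability of the integrals of some simple processes `H_n` with `∫_a^b |H_n - f|² dt → 0` in
probability. -/
def IsItoIntegral (P : Measure Ω) (𝓕 : Filtration ℝ≥0 mΩ) (W f : ℝ≥0 → Ω → ℝ) (a b : ℝ≥0)
    (I : Ω → ℝ) : Prop :=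
  AEMeasurable I P ∧
  StronglyAdapted 𝓕 f ∧
  (∀ᵐ ω ∂P, MemLp (fun t : ℝ => f t.toNNReal ω) 2
    (volume.restrict (Set.Icc (a : ℝ) (b : ℝ)))) ∧
  ∃ H : ℕ → ItoSimpleProcess 𝓕 a b,
    (∀ ε : ℝ≥0∞, 0 < ε →
      Tendsto (fun n => P {ω | ε ≤ ∫⁻ t in Set.Icc (a : ℝ) (b : ℝ),
        ‖(H n).val t.toNNReal ω - f t.toNNReal ω‖ₑ ^ 2}) atTop (𝓝 0)) ∧
    TendstoInMeasure P (fun n => (H n).integral W) atTop I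

end

/-!
Write `t_j^*` for the evaluation points. A first order Taylor expansion of `Φ` at `W_{t_{j-1}}`
gives
`Φ(W_{t_j^*}) ΔW_j ≈ Φ(W_{t_{j-1}}) ΔW_j + Φ'(W_{t_{j-1}}) (W_{t_j^*} - W_{t_{j-1}}) ΔW_j`.
Splitting `ΔW_j` at `t_j^*`, the second summand contributes the weighted quadratic variation
`∑ Φ'(W_{t_{j-1}}) (W_{t_j^*} - W_{t_{j-1}})^2`, with limit `lam * ∫ Φ'(W_t) dt`, and a martingale
transform with vanishing limit. The Taylor remainder is a little-o of a quadratic variation, along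
each continuous path. The left point sums converge by Itô's formula for an antiderivative of `Φ`,
which is obtained in the same way from the second order expansion.

That a martingale transform vanishes in probability as soon as its bracket does is Lenglart's
inequality. No localisation of `Φ` is then needed, and the simple processes approximating `Φ(W)` may
be arbitrary: on a common refinement, their integral differs from a left point sum by a transform
whose bracket is at most twice the sum of the squared `L²` distances from `Φ(W)`.
-/

lemma sum_succ_sub_castSucc {A : Type*} [AddCommGroup A] {n : ℕ} (f : Fin (n + 1) → A) :
    ∑ j : Fin n, (f j.succ - f j.castSucc) = f (Fin.last n) - f 0 := by
  induction n with
  | zero => simp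
  | succ n ih =>
    have h := ih fun i => f i.castSucc
    simp only [Fin.castSucc_zero, ← Fin.succ_castSucc] at h
    rw [Fin.sum_univ_castSucc, h, Fin.succ_last]
    abel

lemma isLittleO_sum_of_forall_norm_le {ι E : Type*} [SeminormedAddCommGroup E] {l : Filter ι}
    {κ : ι → Type*} [∀ i, Fintype (κ i)] {R : ∀ i, κ i → E} {w : ∀ i, κ i → ℝ}
    (h : ∀ η > 0, ∀ᶠ i in l, ∀ k, ‖R i k‖ ≤ η * w i k) :
    (fun i => ∑ k, R i k) =o[l] fun i => ∑ k, w i k := by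
  refine Asymptotics.isLittleO_iff.2 fun η hη => ?_
  filter_upwards [h η hη] with i hi
  calc ‖∑ k, R i k‖ ≤ ∑ k, η * w i k := norm_sum_le_of_le _ fun k _ => hi k
    _ ≤ η * ‖∑ k, w i k‖ := by
      rw [← Finset.mul_sum]
      exact mul_le_mul_of_nonneg_left (le_abs_self _) hη.le

lemma enorm_sq_eq_ofReal_sq (x : ℝ) : ‖x‖ₑ ^ 2 = ENNReal.ofReal (x ^ 2) := by
  rw [Real.enorm_eq_ofReal_abs, ← ENNReal.ofReal_pow (abs_nonneg x), sq_abs]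

lemma edist_zero_right_ennreal (x : ℝ≥0∞) : edist x 0 = x := by
  induction x with
  | top => simp [ENNReal.edist_eq_top_iff]
  | coe x => exact (edist_nndist x 0).trans (by simp)

section ConvergenceInMeasure

variable {α E : Type*} {mα : MeasurableSpace α} {μ : Measure α} [SeminormedAddCommGroup E]
  {ι : Type*} {l : Filter ι}

lemma tendstoInMeasure_const (f : α → E) : TendstoInMeasure μ (fun _ : ι => f) l f := by
  intro ε hε
  simpa [hε.ne'] using tendsto_const_nhds

lemma tendstoInMeasure_of_edist_le_const_mul_add {F : Type*} [EDist F] {f : ι → α → F}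
    {g : α → F} {G H : ι → α → ℝ≥0∞} (hG : TendstoInMeasure μ G l 0) (hH : TendstoInMeasure μ H l 0)
    {C : ℝ≥0} (h : ∀ i, ∀ᵐ x ∂μ, edist (f i x) (g x) ≤ C * (G i x + H i x)) :
    TendstoInMeasure μ f l g := by
  simp only [TendstoInMeasure, Pi.zero_apply, edist_zero_right_ennreal] at hG hH
  intro ε hε
  have hC : (C + 1 : ℝ≥0∞) ≠ 0 := by simp
  have hC_top : (C + 1 : ℝ≥0∞) ≠ ∞ := by finiteness
  set δ := ε / (C + 1) / 2
  have hδ : 0 < δ := ENNReal.half_pos (ENNReal.div_pos hε.ne' hC_top).ne'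
  have hsum := (hG δ hδ).add (hH δ hδ)
  rw [add_zero] at hsum
  refine tendsto_of_tendsto_of_tendsto_of_le_of_le tendsto_const_nhds hsum (fun _ => zero_le)
    fun i => (measure_mono_ae ?_).trans (measure_union_le _ _)
  filter_upwards [h i] with x hx hεx
  by_contra hlt
  obtain ⟨hGx, hHx⟩ : ¬δ ≤ G i x ∧ ¬δ ≤ H i x := not_or.1 hlt
  refine (hεx.trans hx).not_gt ?_
  calc C * (G i x + H i x) ≤ (C + 1) * (G i x + H i x) := by gcongr; exact le_self_add
    _ < (C + 1) * (ε / (C + 1)) := by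
        rw [ENNReal.mul_lt_mul_iff_right hC hC_top]
        exact (ENNReal.add_lt_add (not_le.1 hGx) (not_le.1 hHx)).trans_le (ENNReal.add_halves _).le
    _ = ε := ENNReal.mul_div_cancel hC hC_top

lemma tendstoInMeasure_edist {F : Type*} [EDist F] {f : ι → α → F} {g : α → F}
    (h : TendstoInMeasure μ f l g) :
    TendstoInMeasure μ (fun i x => edist (f i x) (g x)) l 0 := by
  simpa only [TendstoInMeasure, Pi.zero_apply, edist_zero_right_ennreal] using h

lemma tendstoInMeasure_add {f g : ι → α → E} {f' g' : α → E} (hf : TendstoInMeasure μ f l f')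
    (hg : TendstoInMeasure μ g l g') :
    TendstoInMeasure μ (fun i x => f i x + g i x) l (fun x => f' x + g' x) :=
  tendstoInMeasure_of_edist_le_const_mul_add (C := 1) (tendstoInMeasure_edist hf)
    (tendstoInMeasure_edist hg) fun _ => .of_forall fun _ => by
      simpa using edist_add_add_le _ _ _ _

lemma tendstoInMeasure_const_mul {f : ι → α → ℝ} {f' : α → ℝ} (c : ℝ)
    (hf : TendstoInMeasure μ f l f') :
    TendstoInMeasure μ (fun i x => c * f i x) l (fun x => c * f' x) :=
  tendstoInMeasure_of_edist_le_const_mul_add (C := ‖c‖₊) (tendstoInMeasure_edist hf)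
    (tendstoInMeasure_edist hf) fun i => .of_forall fun x => by
      rw [edist_eq_enorm_sub, ← mul_sub, enorm_mul, ← edist_eq_enorm_sub]
      exact mul_le_mul_right le_self_add _

lemma tendstoInMeasure_zero_of_tendsto_ae [IsFiniteMeasure μ] [l.IsCountablyGenerated]
    [Countable ι] {G : ι → α → ℝ≥0∞} (hG : ∀ i, AEMeasurable (G i) μ)
    (h : ∀ᵐ x ∂μ, Tendsto (fun i => G i x) l (𝓝 0)) : TendstoInMeasure μ G l 0 := by
  refine TendstoInMeasure.congr_left (fun i => (hG i).ae_eq_mk.symm) fun ε hε => ?_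
  simp only [Pi.zero_apply, edist_zero_right_ennreal]
  rw [← measure_empty (μ := μ)]
  refine tendsto_measure_of_ae_tendsto_indicator_of_isFiniteMeasure l .empty
    (fun i => measurableSet_le measurable_const (hG i).measurable_mk) ?_
  filter_upwards [h, ae_all_iff.2 fun i => (hG i).ae_eq_mk] with x hx hmk
  filter_upwards [hx.eventually_lt_const hε] with i hi
  simpa [← hmk i] using hi

/- Along a subsequence on which `Q` converges almost everywhere, it is bounded at almost every
point, so that there `R` converges. -/
lemma tendstoInMeasure_of_isLittleO [IsFiniteMeasure μ] [l.IsCountablyGenerated]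
    {F : Type*} [SeminormedAddCommGroup F] {R : ι → α → E} {r : α → E} {Q : ι → α → F} {q : α → F}
    (hQ : TendstoInMeasure μ Q l q) (hR : ∀ i, AEStronglyMeasurable (R i) μ)
    (h : ∀ᵐ x ∂μ, (fun i => R i x - r x) =o[l] fun i => Q i x) :
    TendstoInMeasure μ R l r := by
  intro ε hε
  refine tendsto_of_seq_tendsto fun u hu => ?_
  suffices TendstoInMeasure μ (fun n => R (u n)) atTop r from this ε hε
  rw [exists_seq_tendstoInMeasure_atTop_iff fun n => hR (u n)]
  intro ns hns
  obtain ⟨ns', hns', hQlim⟩ := (hQ.comp (hu.comp hns.tendsto_atTop)).exists_seq_tendsto_ae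
  refine ⟨ns', hns', ?_⟩
  filter_upwards [h, hQlim] with x hx hQx
  have hsub : Tendsto (fun k => u (ns (ns' k))) atTop l :=
    hu.comp (hns.tendsto_atTop.comp hns'.tendsto_atTop)
  have hzero := (hx.comp_tendsto hsub).trans_isBigO (hQx.isBigO_one ℝ)
  exact tendsto_sub_nhds_zero_iff.1 ((Asymptotics.isLittleO_one_iff ℝ).1 hzero)

lemma tendstoInMeasure_of_tendsto_ae_filter [IsFiniteMeasure μ] [l.IsCountablyGenerated]
    {R : ι → α → E} {r : α → E} (hR : ∀ i, AEStronglyMeasurable (R i) μ)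
    (h : ∀ᵐ x ∂μ, Tendsto (fun i => R i x) l (𝓝 (r x))) : TendstoInMeasure μ R l r := by
  refine tendstoInMeasure_of_isLittleO (tendstoInMeasure_const fun _ => (1 : ℝ)) hR ?_
  filter_upwards [h] with x hx
  exact (Asymptotics.isLittleO_one_iff ℝ).2 (tendsto_sub_nhds_zero_iff.2 hx)

end ConvergenceInMeasure

namespace TimePartition

variable {a b : ℝ≥0} (π : TimePartition a b) (j : Fin π.n)

/-- The left end point of the `j`-th subinterval. -/
abbrev left : ℝ≥0 := π.pt j.castSucc

/-- The right end point of the `j`-th subinterval. -/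
abbrev right : ℝ≥0 := π.pt j.succ

/-- The length of the `j`-th subinterval, as a real number. -/
def length : ℝ := π.right j - π.left j

lemma pt_mem_Icc (i : Fin (π.n + 1)) : π.pt i ∈ Set.Icc a b :=
  ⟨π.first.symm.trans_le (π.strictMono.monotone (Fin.zero_le i)),
    (π.strictMono.monotone (Fin.le_last i)).trans_eq π.last⟩

lemma left_lt_right : π.left j < π.right j := π.strictMono Fin.castSucc_lt_succ

lemma length_nonneg : 0 ≤ π.length j :=
  sub_nonneg.2 (NNReal.coe_le_coe.2 (π.left_lt_right j).le)

lemma Icc_left_right_subset : Set.Icc (π.left j) (π.right j) ⊆ Set.Icc a b :=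
  Set.Icc_subset_Icc (π.pt_mem_Icc _).1 (π.pt_mem_Icc _).2

lemma monotone_left : Monotone π.left :=
  π.strictMono.monotone.comp Fin.strictMono_castSucc.monotone

lemma right_le_left {i j : Fin π.n} (hij : i < j) : π.right i ≤ π.left j :=
  π.strictMono.monotone (Fin.succ_le_castSucc_iff.2 hij)

lemma pairwise_disjoint_Ioc :
    Pairwise (Function.onFun Disjoint fun j : Fin π.n => Set.Ioc (π.left j) (π.right j)) :=
  (pairwise_disjoint_on _).2 fun _ _ hij => Set.disjoint_left.2 fun _ hi hj =>
    (hi.2.trans (π.right_le_left hij)).not_gt hj.1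

lemma iUnion_Ioc : ⋃ j, Set.Ioc (π.left j) (π.right j) = Set.Ioc a b := by
  refine Set.Subset.antisymm (Set.iUnion_subset fun j t ht => ?_) fun t ht => ?_
  · exact ⟨(π.pt_mem_Icc _).1.trans_lt ht.1, ht.2.trans (π.pt_mem_Icc _).2⟩
  · by_contra! hout
    have hlt : ∀ i, π.pt i < t := Fin.induction (π.first.trans_lt ht.1) fun j hj =>
      not_le.1 fun hle => hout (Set.mem_iUnion.2 ⟨j, hj, hle⟩)
    exact ht.2.not_gt (π.last ▸ hlt (Fin.last _))

lemma sum_length : ∑ j, π.length j = b - a :=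
  (sum_succ_sub_castSucc fun i => (π.pt i : ℝ)).trans (by rw [π.first, π.last])

lemma length_le_diam : π.length j ≤ π.diam := by
  rw [length, ← NNReal.coe_sub (π.left_lt_right j).le, NNReal.coe_le_coe]
  exact Finset.le_sup (f := fun j : Fin π.n => π.right j - π.left j) (Finset.mem_univ j)

section Tag

/-- The point `lam * t_j + (1 - lam) * t_{j-1}` of the `j`-th subinterval. For `1 < lam` the
truncated subtraction makes the second term zero, so `lam ≤ 1` is assumed wherever this matters. -/
noncomputable def tag (lam : ℝ≥0) (j : Fin π.n) : ℝ≥0 :=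
  lam * π.right j + (1 - lam) * π.left j

lemma tag_zero : π.tag 0 j = π.left j := by simp [tag]

lemma tag_one : π.tag 1 j = π.right j := by simp [tag]

variable {lam : ℝ≥0} (hlam : lam ≤ 1)
include hlam

lemma coe_tag : (π.tag lam j : ℝ) = π.left j + lam * π.length j := by
  simp only [tag, length, NNReal.coe_add, NNReal.coe_mul, NNReal.coe_sub hlam, NNReal.coe_one]
  ring

lemma tag_mem_Icc : π.tag lam j ∈ Set.Icc (π.left j) (π.right j) := by
  simp only [Set.mem_Icc, ← NNReal.coe_le_coe, π.coe_tag j hlam]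
  have hlen := mul_le_of_le_one_left (π.length_nonneg j) (NNReal.coe_le_one.2 hlam)
  exact ⟨le_add_of_nonneg_right (mul_nonneg lam.coe_nonneg (π.length_nonneg j)),
    (add_le_add_right hlen _).trans_eq (add_sub_cancel _ _)⟩

omit j in
lemma monotone_tag : Monotone (π.tag lam) := monotone_iff_forall_lt.2 fun i j hij =>
  (π.tag_mem_Icc i hlam).2.trans ((π.right_le_left hij).trans (π.tag_mem_Icc j hlam).1)

end Tag

section FinePartitions

instance : (diamToZero a b).IsCountablyGenerated := by unfold diamToZero; infer_instance

lemma eventually_diam_lt {δ : ℝ} (hδ : 0 < δ) :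
    ∀ᶠ π : TimePartition a b in diamToZero a b, (π.diam : ℝ) < δ :=
  (NNReal.tendsto_coe.2 tendsto_comap).eventually_lt_const hδ

lemma eventually_abs_mul_length_le (C : ℝ) :
    ∀ η > 0, ∀ᶠ π : TimePartition a b in diamToZero a b, ∀ j, |C * π.length j| ≤ η := by
  intro η hη
  filter_upwards [eventually_diam_lt (δ := η / (|C| + 1)) (by positivity)] with π hπ j
  have hlen := ((π.length_le_diam j).trans_lt hπ).le
  rw [le_div_iff₀ (by positivity)] at hlen
  rw [abs_mul, abs_of_nonneg (π.length_nonneg j)]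
  linarith [π.length_nonneg j]

lemma eventually_dist_left_le {E : Type*} [PseudoMetricSpace E] {x : ℝ≥0 → E}
    (hx : ContinuousOn x (Set.Icc a b)) {η : ℝ} (hη : 0 < η) :
    ∀ᶠ π : TimePartition a b in diamToZero a b, ∀ j : Fin π.n,
      ∀ t ∈ Set.Icc (π.left j) (π.right j), dist (x t) (x (π.left j)) ≤ η := by
  obtain ⟨δ, hδ, hxδ⟩ := Metric.uniformContinuousOn_iff.1
    (isCompact_Icc.uniformContinuousOn_of_continuous hx) η hη
  filter_upwards [eventually_diam_lt hδ] with π hπ j t ht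
  refine (hxδ t (π.Icc_left_right_subset j ht) _ (π.pt_mem_Icc _) ?_).le
  calc dist t (π.left j) = t - π.left j := by
        rw [NNReal.dist_eq, abs_of_nonneg (sub_nonneg.2 (NNReal.coe_le_coe.2 ht.1))]
    _ ≤ π.length j := sub_le_sub_right (NNReal.coe_le_coe.2 ht.2) _
    _ < δ := (π.length_le_diam j).trans_lt hπ

lemma tendsto_riemannSum {h : ℝ≥0 → ℝ} (hh : Continuous h) :
    Tendsto (fun π : TimePartition a b => ∑ j, h (π.left j) * π.length j) (diamToZero a b)
      (𝓝 (∫ t in (a : ℝ)..b, h t.toNNReal)) := by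
  have hint (s t : ℝ) : IntervalIntegrable (fun t : ℝ => h t.toNNReal) volume s t :=
    (hh.comp continuous_real_toNNReal).intervalIntegrable s t
  have hpiece : (fun π : TimePartition a b => ∑ j, (h (π.left j) * π.length j -
      ∫ t in (π.left j : ℝ)..π.right j, h t.toNNReal)) =o[diamToZero a b]
      fun π => ∑ j, π.length j := by
    refine isLittleO_sum_of_forall_norm_le fun η hη => ?_
    filter_upwards [eventually_dist_left_le hh.continuousOn hη] with π hπ j
    have hle : (π.left j : ℝ) ≤ π.right j := NNReal.coe_le_coe.2 (π.left_lt_right j).le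
    have hconst : h (π.left j) * π.length j =
        ∫ _ in (π.left j : ℝ)..π.right j, h (π.left j) := by simp [length, mul_comm]
    rw [hconst, ← intervalIntegral.integral_sub (by simp) (hint _ _), length,
      ← abs_of_nonneg (sub_nonneg.2 hle)]
    refine intervalIntegral.norm_integral_le_of_norm_le_const fun t ht => ?_
    rw [Set.uIoc_of_le hle] at ht
    rw [norm_sub_rev, ← dist_eq_norm]
    exact hπ j _ ⟨NNReal.le_toNNReal_of_coe_le ht.1.le, Real.toNNReal_le_iff_le_coe.2 ht.2⟩
  have hsplit (π : TimePartition a b) : ∑ j, ∫ t in (π.left j : ℝ)..π.right j, h t.toNNReal =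
      ∫ t in (a : ℝ)..b, h t.toNNReal := by
    have htel := sum_succ_sub_castSucc fun i => ∫ t in (a : ℝ)..π.pt i, h t.toNNReal
    simpa only [π.first, π.last, intervalIntegral.integral_same, sub_zero,
      intervalIntegral.integral_interval_sub_left (hint _ _) (hint _ _)] using htel
  simp only [Finset.sum_sub_distrib, hsplit, sum_length] at hpiece
  rw [← tendsto_sub_nhds_zero_iff, ← Asymptotics.isLittleO_one_iff ℝ]
  exact hpiece.trans_isBigO (Asymptotics.isBigO_const_const _ one_ne_zero _)

lemma tendsto_sum_mul_length_zero {h : ℝ≥0 → ℝ} (hh : Continuous h)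
    {c : ∀ π : TimePartition a b, Fin π.n → ℝ}
    (hc : ∀ η > 0, ∀ᶠ π in diamToZero a b, ∀ j, |c π j| ≤ η) :
    Tendsto (fun π : TimePartition a b => ∑ j, h (π.left j) * c π j * π.length j)
      (diamToZero a b) (𝓝 0) := by
  rw [← Asymptotics.isLittleO_one_iff ℝ]
  refine (isLittleO_sum_of_forall_norm_le (w := fun π j => |h (π.left j)| * π.length j)
    fun η hη => ?_).trans_isBigO ((tendsto_riemannSum hh.abs).isBigO_one ℝ)
  filter_upwards [hc η hη] with π hπ j
  calc ‖h (π.left j) * c π j * π.length j‖ = |c π j| * (|h (π.left j)| * π.length j) := by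
        rw [norm_mul, norm_mul, Real.norm_eq_abs, Real.norm_eq_abs,
          Real.norm_of_nonneg (π.length_nonneg j)]
        ring
    _ ≤ η * (|h (π.left j)| * π.length j) := mul_le_mul_of_nonneg_right (hπ j)
        (mul_nonneg (abs_nonneg _) (π.length_nonneg j))

end FinePartitions

section Refinement

/-- The partition of `[a, b]` whose points are the elements of a finite set. -/
noncomputable def ofFinset (S : Finset ℝ≥0) (hS : (S : Set ℝ≥0) ⊆ Set.Icc a b) (ha : a ∈ S)
    (hb : b ∈ S) : TimePartition a b where
  n := S.card - 1
  pt := S.orderEmbOfFin (Nat.sub_add_cancel (Finset.one_le_card.2 ⟨a, ha⟩)).symm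
  strictMono := OrderEmbedding.strictMono _
  first := by
    refine (S.orderEmbOfFin_zero _ (Nat.succ_pos _)).trans ?_
    exact le_antisymm (S.min'_le a ha) (hS (S.min'_mem _)).1
  last := by
    refine (S.orderEmbOfFin_last _ (Nat.succ_pos _)).trans ?_
    exact le_antisymm (hS (S.max'_mem _)).2 (S.le_max' b hb)

lemma range_pt_ofFinset {S : Finset ℝ≥0} (hS : (S : Set ℝ≥0) ⊆ Set.Icc a b) (ha : a ∈ S)
    (hb : b ∈ S) : Set.range (ofFinset S hS ha hb).pt = S :=
  S.range_orderEmbOfFin _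

/-- `π'` refines `π`: every point of `π` is a point of `π'`. -/
def Refines (π' π : TimePartition a b) : Prop := Set.range π.pt ⊆ Set.range π'.pt

variable {π}

lemma le_left_or_right_le {t : ℝ≥0} (ht : t ∈ Set.range π.pt) : t ≤ π.left j ∨ π.right j ≤ t := by
  obtain ⟨i, rfl⟩ := ht
  rcases le_or_gt i j.castSucc with hi | hi
  · exact .inl (π.strictMono.monotone hi)
  · exact .inr (π.strictMono.monotone (Fin.castSucc_lt_iff_succ_le.1 hi))

/- If a gap were longer than `δ`, its point at distance `δ / 2` from the left end would not be
covered by the balls of radius `δ / 2` around the partition points. -/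
lemma exists_refines_diam_le (π : TimePartition a b) {δ : ℝ≥0} (hδ : 0 < δ) :
    ∃ π' : TimePartition a b, π'.Refines π ∧ π'.diam ≤ δ := by
  classical
  obtain ⟨C, hCab, hCfin, hC⟩ := isCompact_Icc (a := a) (b := b) |>.finite_cover_balls
    (half_pos (NNReal.coe_pos.2 hδ))
  set S : Finset ℝ≥0 := hCfin.toFinset ∪ Finset.univ.image π.pt
  have hS : (S : Set ℝ≥0) ⊆ Set.Icc a b := by
    simpa [S, hCab, Set.range_subset_iff] using fun i => π.pt_mem_Icc i
  have hpt : Set.range π.pt ⊆ S := by simp [S]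
  set π' := ofFinset S hS (hpt ⟨0, π.first⟩) (hpt ⟨_, π.last⟩)
  have hrange : Set.range π'.pt = S := range_pt_ofFinset hS _ _
  refine ⟨π', hpt.trans_eq hrange.symm, Finset.sup_le fun j _ => ?_⟩
  rw [tsub_le_iff_left]
  by_contra! hgap
  have hmid : π'.left j + δ / 2 ∈ Set.Icc a b :=
    ⟨(π'.pt_mem_Icc _).1.trans le_self_add, (add_le_add_right (half_le_self zero_le) _).trans
      (hgap.le.trans (π'.pt_mem_Icc _).2)⟩
  obtain ⟨t, ht, hball⟩ := Set.mem_iUnion₂.1 (hC hmid)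
  have hdist : |(π'.left j + δ / 2 - t : ℝ)| < δ / 2 := by
    simpa [Metric.mem_ball, NNReal.dist_eq] using hball
  obtain ⟨hright, hleft⟩ := abs_lt.1 hdist
  have ht' : t ∈ Set.range π'.pt := hrange ▸ by simp [S, ht]
  rcases π'.le_left_or_right_le j ht' with h | h
  · linarith [NNReal.coe_le_coe.2 h]
  · linarith [NNReal.coe_le_coe.2 h]

lemma exists_seq_refines (π : ℕ → TimePartition a b) :
    ∃ u : ℕ → TimePartition a b, (∀ n, (u n).Refines (π n)) ∧
      Tendsto u atTop (diamToZero a b) := by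
  choose u hu hdiam using fun n =>
    exists_refines_diam_le (π n) (δ := 1 / (n + 1)) (by positivity)
  refine ⟨u, hu, tendsto_comap_iff.2 (tendsto_of_tendsto_of_tendsto_of_le_of_le tendsto_const_nhds
    tendsto_one_div_add_atTop_nhds_zero_nat (fun _ => zero_le) hdiam)⟩

lemma diamToZero_neBot (hab : a ≤ b) : (diamToZero a b).NeBot := by
  obtain ⟨u, -, hu⟩ := exists_seq_refines fun _ =>
    ofFinset (a := a) (b := b) {a, b} (by simp [Set.insert_subset_iff, hab]) (by simp) (by simp)
  exact hu.neBot

end Refinement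

end TimePartition

section SquareIntegrable

variable {α : Type*} {mα : MeasurableSpace α} {μ : Measure α}

lemma memLp_two_of_lintegral_sq_ne_top {f : α → ℝ} (hf : AEStronglyMeasurable f μ)
    (h : ∫⁻ x, ‖f x‖ₑ ^ 2 ∂μ ≠ ∞) : MemLp f 2 μ := by
  refine (memLp_two_iff_integrable_sq hf).2 ⟨hf.pow 2, ?_⟩
  simpa only [HasFiniteIntegral, enorm_pow] using h.lt_top

lemma lintegral_sq_eq_ofReal_integral {f : α → ℝ} (hf : MemLp f 2 μ) :
    ∫⁻ x, ‖f x‖ₑ ^ 2 ∂μ = ENNReal.ofReal (∫ x, f x ^ 2 ∂μ) := by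
  rw [ofReal_integral_eq_lintegral_ofReal hf.integrable_sq (.of_forall fun _ => sq_nonneg _)]
  simp_rw [enorm_sq_eq_ofReal_sq]

lemma lintegral_sq_sum_of_orthogonal {ι : Type*} [Fintype ι] {f : ι → α → ℝ}
    (hf : ∀ i, MemLp (f i) 2 μ) (horth : Pairwise fun i j => ∫ x, f i x * f j x ∂μ = 0) :
    ∫⁻ x, ‖∑ i, f i x‖ₑ ^ 2 ∂μ = ∑ i, ∫⁻ x, ‖f i x‖ₑ ^ 2 ∂μ := by
  have hint (i j) : Integrable (fun x => f i x * f j x) μ := (hf i).integrable_mul (hf j)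
  rw [lintegral_sq_eq_ofReal_integral (memLp_finsetSum _ fun i _ => hf i)]
  simp_rw [lintegral_sq_eq_ofReal_integral (hf _)]
  rw [← ENNReal.ofReal_sum_of_nonneg fun i _ => integral_nonneg fun _ => sq_nonneg _]
  congr 1
  simp_rw [sq, Finset.sum_mul_sum]
  rw [integral_finsetSum _ fun i _ => integrable_finsetSum _ fun j _ => hint i j]
  refine Finset.sum_congr rfl fun i _ => ?_
  rw [integral_finsetSum _ fun j _ => hint i j]
  exact Finset.sum_eq_single i (fun j _ hj => horth hj.symm) (by simp)

lemma measure_le_abs_le_of_lintegral_sq_le {f : α → ℝ} (hf : AEMeasurable f μ) {δ ε : ℝ}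
    (hε : 0 < ε) (h : ∫⁻ x, ‖f x‖ₑ ^ 2 ∂μ ≤ ENNReal.ofReal δ) :
    μ {x | ε ≤ |f x|} ≤ ENNReal.ofReal (δ / ε ^ 2) := by
  have hε2 : 0 < ε ^ 2 := by positivity
  calc μ {x | ε ≤ |f x|} ≤ μ {x | ENNReal.ofReal (ε ^ 2) ≤ ‖f x‖ₑ ^ 2} := by
        refine measure_mono fun x hx => ?_
        rw [Set.mem_ofPred_eq, enorm_sq_eq_ofReal_sq, ← sq_abs (f x)]
        exact ENNReal.ofReal_le_ofReal (pow_le_pow_left₀ hε.le hx 2)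
    _ ≤ (∫⁻ x, ‖f x‖ₑ ^ 2 ∂μ) / ENNReal.ofReal (ε ^ 2) :=
        meas_ge_le_lintegral_div (by fun_prop) (by simpa using hε.ne') (by simp)
    _ ≤ ENNReal.ofReal (δ / ε ^ 2) := by
        rw [ENNReal.ofReal_div_of_pos hε2]
        exact ENNReal.div_le_div_right h _

end SquareIntegrable

section MartingaleTransform

variable {ι : Type*} [LinearOrder ι] {Ω : Type*} {mΩ : MeasurableSpace Ω}

/-- Square integrable centred variables `Z j` such that `Z j` is independent of the `σ`-algebra
`𝓖 j`, which describes the past strictly before `j`: the earlier `Z i` are `𝓖 j`-measurable, but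
`Z j` itself is not. Hence `∑ j, Y j * Z j` is a martingale transform when `Y` is adapted. -/
structure IsCentredNoise (Z : ι → Ω → ℝ) (𝓖 : Filtration ι mΩ) (P : Measure Ω) : Prop where
  memLp : ∀ j, MemLp (Z j) 2 P
  measurable_of_lt : ∀ i j, i < j → Measurable[𝓖 j] (Z i)
  indep : ∀ j, Indep (MeasurableSpace.comap (Z j) inferInstance) (𝓖 j) P
  integral_eq_zero : ∀ j, ∫ ω, Z j ω ∂P = 0

namespace IsCentredNoise

variable {P : Measure Ω} {𝓖 : Filtration ι mΩ} {Z Y : ι → Ω → ℝ}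

lemma indepFun (hZ : IsCentredNoise Z 𝓖 P) {j : ι} {X : Ω → ℝ} (hX : Measurable[𝓖 j] X) :
    IndepFun X (Z j) P :=
  (IndepFun_iff_Indep _ _ _).2 (indep_of_indep_of_le_left (hZ.indep j).symm hX.comap_le)

lemma integral_mul_eq_zero (hZ : IsCentredNoise Z 𝓖 P) {j : ι} {X : Ω → ℝ}
    (hX : Measurable[𝓖 j] X) : ∫ ω, X ω * Z j ω ∂P = 0 := by
  rw [(hZ.indepFun hX).integral_fun_mul_eq_mul_integral (hX.mono (𝓖.le j) le_rfl
    |>.aestronglyMeasurable) (hZ.memLp j).1, hZ.integral_eq_zero, mul_zero]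

lemma lintegral_sq_mul (hZ : IsCentredNoise Z 𝓖 P) {j : ι} {X : Ω → ℝ} (hX : Measurable[𝓖 j] X) :
    ∫⁻ ω, ‖X ω * Z j ω‖ₑ ^ 2 ∂P = ∫⁻ ω, ENNReal.ofReal (X ω ^ 2 * ∫ ω', Z j ω' ^ 2 ∂P) ∂P := by
  have hXm : Measurable X := hX.mono (𝓖.le j) le_rfl
  have hZm : AEMeasurable (Z j) P := (hZ.memLp j).1.aemeasurable
  have hsq : Measurable fun x : ℝ => ‖x‖ₑ ^ 2 := by fun_prop
  have hindep : IndepFun (fun ω => ‖X ω‖ₑ ^ 2) (fun ω => ‖Z j ω‖ₑ ^ 2) P :=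
    (hZ.indepFun hX).comp hsq hsq
  simp_rw [enorm_mul, mul_pow]
  rw [lintegral_mul_eq_lintegral_mul_lintegral_of_indepFun'' (by fun_prop) (by fun_prop)
    hindep, lintegral_sq_eq_ofReal_integral (hZ.memLp j),
    ← lintegral_mul_const _ (by fun_prop)]
  simp_rw [enorm_sq_eq_ofReal_sq, ENNReal.ofReal_mul (sq_nonneg _)]

lemma measurable_mul (hZ : IsCentredNoise Z 𝓖 P) (hY : Adapted 𝓖 Y) {i j : ι} (hij : i < j) :
    Measurable[𝓖 j] fun ω => Y i ω * Z i ω :=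
  ((hY i).mono (𝓖.mono hij.le) le_rfl).mul (hZ.measurable_of_lt i j hij)

lemma aestronglyMeasurable_mul (hZ : IsCentredNoise Z 𝓖 P) (hY : Adapted 𝓖 Y) (j : ι) :
    AEStronglyMeasurable (fun ω => Y j ω * Z j ω) P :=
  ((hY j).mono (𝓖.le j) le_rfl).aestronglyMeasurable.mul (hZ.memLp j).1

lemma pairwise_orthogonal (hZ : IsCentredNoise Z 𝓖 P) (hY : Adapted 𝓖 Y) :
    Pairwise fun i j => ∫ ω, (Y i ω * Z i ω) * (Y j ω * Z j ω) ∂P = 0 := by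
  have horth (i j) (hij : i < j) : ∫ ω, (Y i ω * Z i ω) * (Y j ω * Z j ω) ∂P = 0 := by
    simp_rw [← mul_assoc]
    exact hZ.integral_mul_eq_zero ((hZ.measurable_mul hY hij).mul (hY j))
  intro i j hij
  rcases hij.lt_or_gt with hlt | hgt
  · exact horth i j hlt
  · simpa only [mul_comm] using horth j i hgt

variable [Fintype ι] [IsProbabilityMeasure P]

lemma lintegral_sq_transform_le (hZ : IsCentredNoise Z 𝓖 P) (hY : Adapted 𝓖 Y) {δ : ℝ}
    (hδ : ∀ ω, ∑ j, Y j ω ^ 2 * ∫ ω', Z j ω' ^ 2 ∂P ≤ δ) :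
    ∫⁻ ω, ‖∑ j, Y j ω * Z j ω‖ₑ ^ 2 ∂P ≤ ENNReal.ofReal δ := by
  have hYm (j) : Measurable (Y j) := (hY j).mono (𝓖.le j) le_rfl
  have hsum : ∑ j, ∫⁻ ω, ‖Y j ω * Z j ω‖ₑ ^ 2 ∂P ≤ ENNReal.ofReal δ :=
    calc ∑ j, ∫⁻ ω, ‖Y j ω * Z j ω‖ₑ ^ 2 ∂P
      _ = ∫⁻ ω, ∑ j, ENNReal.ofReal (Y j ω ^ 2 * ∫ ω', Z j ω' ^ 2 ∂P) ∂P := by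
        rw [lintegral_finsetSum _ fun j _ => by have := hYm j; fun_prop]
        exact Finset.sum_congr rfl fun j _ => hZ.lintegral_sq_mul (hY j)
      _ ≤ ∫⁻ _, ENNReal.ofReal δ ∂P := by
        refine lintegral_mono fun ω => ?_
        simp only
        rw [← ENNReal.ofReal_sum_of_nonneg fun j _ => by positivity]
        exact ENNReal.ofReal_le_ofReal (hδ ω)
      _ = ENNReal.ofReal δ := by simp
  have hmem (j) : MemLp (fun ω => Y j ω * Z j ω) 2 P := by
    refine memLp_two_of_lintegral_sq_ne_top (hZ.aestronglyMeasurable_mul hY j) ?_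
    refine ne_top_of_le_ne_top ENNReal.ofReal_ne_top (le_trans ?_ hsum)
    exact Finset.single_le_sum (f := fun j => ∫⁻ ω, ‖Y j ω * Z j ω‖ₑ ^ 2 ∂P)
      (fun _ _ => zero_le) (Finset.mem_univ j)
  rwa [lintegral_sq_sum_of_orthogonal hmem (hZ.pairwise_orthogonal hY)]

end IsCentredNoise

/- `Y'` is `Y` stopped when the partial sums of `Y j ^ 2 * c j` exceed `δ`. -/
lemma exists_adapted_truncation [Fintype ι] {𝓖 : Filtration ι mΩ} {Y : ι → Ω → ℝ}
    (hY : Adapted 𝓖 Y) {c : ι → ℝ} (hc : ∀ j, 0 ≤ c j) {δ : ℝ} (hδ : 0 ≤ δ) :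
    ∃ Y' : ι → Ω → ℝ, Adapted 𝓖 Y' ∧ (∀ ω, ∑ j, Y' j ω ^ 2 * c j ≤ δ) ∧
      ∀ ω, ∑ j, Y j ω ^ 2 * c j ≤ δ → ∀ j, Y' j ω = Y j ω := by
  have hnn (j ω) : 0 ≤ Y j ω ^ 2 * c j := mul_nonneg (sq_nonneg _) (hc j)
  set A : ι → Ω → ℝ := fun j ω => ∑ i with i ≤ j, Y i ω ^ 2 * c i
  have hA : Adapted 𝓖 A := fun j => Finset.measurable_fun_sum _ fun i hi =>
    (((hY i).mono (𝓖.mono (Finset.mem_filter.1 hi).2) le_rfl).pow_const 2).mul_const _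
  refine ⟨fun j ω => if A j ω ≤ δ then Y j ω else 0, fun j => ?_, fun ω => ?_, fun ω hω j => ?_⟩
  · exact Measurable.ite (measurableSet_le (hA j) measurable_const) (hY j) measurable_const
  · have hactive : ∑ j, (if A j ω ≤ δ then Y j ω else 0) ^ 2 * c j =
        ∑ j with A j ω ≤ δ, Y j ω ^ 2 * c j := by
      rw [Finset.sum_filter]
      exact Finset.sum_congr rfl fun j _ => by split_ifs <;> simp
    rw [hactive]
    rcases (Finset.univ.filter fun j => A j ω ≤ δ).eq_empty_or_nonempty with hempty | hne
    · simpa [hempty] using hδ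
    · refine le_trans ?_ (Finset.mem_filter.1 (Finset.max'_mem _ hne)).2
      exact Finset.sum_le_sum_of_subset_of_nonneg
        (fun i hi => by simpa using Finset.le_max' _ i hi) fun i _ _ => hnn i ω
  · exact if_pos ((Finset.sum_le_sum_of_subset_of_nonneg (Finset.subset_univ _)
      fun i _ _ => hnn i ω).trans hω)

/-- **Lenglart's inequality** for a discrete martingale transform. -/
lemma IsCentredNoise.measure_le_abs_transform_le [Fintype ι] {P : Measure Ω}
    [IsProbabilityMeasure P] {𝓖 : Filtration ι mΩ} {Z Y : ι → Ω → ℝ}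
    (hZ : IsCentredNoise Z 𝓖 P) (hY : Adapted 𝓖 Y) {δ ε : ℝ} (hδ : 0 ≤ δ) (hε : 0 < ε) :
    P {ω | ε ≤ |∑ j, Y j ω * Z j ω|} ≤
      ENNReal.ofReal (δ / ε ^ 2) + P {ω | δ < ∑ j, Y j ω ^ 2 * ∫ ω', Z j ω' ^ 2 ∂P} := by
  obtain ⟨Y', hY', hbound, heq⟩ := exists_adapted_truncation hY
    (c := fun j => ∫ ω', Z j ω' ^ 2 ∂P) (fun j => by positivity) hδ
  have hmeas : AEMeasurable (fun ω => ∑ j, Y' j ω * Z j ω) P :=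
    Finset.aemeasurable_fun_sum _ fun j _ => (hZ.aestronglyMeasurable_mul hY' j).aemeasurable
  refine (measure_mono fun ω hω => ?_).trans ((measure_union_le _ _).trans
    (add_le_add_left (measure_le_abs_le_of_lintegral_sq_le hmeas hε
      (hZ.lintegral_sq_transform_le hY' hbound)) _))
  rcases lt_or_ge δ (∑ j, Y j ω ^ 2 * ∫ ω', Z j ω' ^ 2 ∂P) with hlt | hle
  · exact .inr hlt
  · refine .inl ?_
    simpa only [Set.mem_ofPred_eq, heq ω hle] using hω

lemma tendstoInMeasure_transform_zero {P : Measure Ω} [IsProbabilityMeasure P] {κ : Type*}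
    {l : Filter κ} {ι : κ → Type*} [∀ k, LinearOrder (ι k)] [∀ k, Fintype (ι k)]
    {𝓖 : ∀ k, Filtration (ι k) mΩ} {Z Y : ∀ k, ι k → Ω → ℝ}
    (hZ : ∀ k, IsCentredNoise (Z k) (𝓖 k) P) (hY : ∀ k, Adapted (𝓖 k) (Y k))
    (hbracket : TendstoInMeasure P (fun k ω => ∑ j, Y k j ω ^ 2 * ∫ ω', Z k j ω' ^ 2 ∂P) l 0) :
    TendstoInMeasure P (fun k ω => ∑ j, Y k j ω * Z k j ω) l 0 := by
  rw [tendstoInMeasure_iff_dist] at hbracket ⊢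
  intro ε hε
  simp only [Pi.zero_apply, dist_zero_right, Real.norm_eq_abs] at hbracket ⊢
  refine ENNReal.tendsto_nhds_zero.2 fun ρ hρ => ?_
  obtain ⟨δ, hδ, hδρ⟩ : ∃ δ : ℝ, 0 < δ ∧ ENNReal.ofReal (δ / ε ^ 2) ≤ ρ / 2 := by
    obtain ⟨c, hc, hcρ⟩ := ENNReal.lt_iff_exists_nnreal_btwn.1 (ENNReal.half_pos hρ.ne')
    have hc' : 0 < (c : ℝ) := by simpa using hc
    exact ⟨c * ε ^ 2, by positivity, by
      rw [mul_div_cancel_right₀ _ (by positivity), ENNReal.ofReal_coe_nnreal]; exact hcρ.le⟩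
  filter_upwards [ENNReal.tendsto_nhds_zero.1 (hbracket δ hδ) _ (ENNReal.half_pos hρ.ne')] with k hk
  calc P {ω | ε ≤ |∑ j, Y k j ω * Z k j ω|}
    _ ≤ ENNReal.ofReal (δ / ε ^ 2) + P {ω | δ < ∑ j, Y k j ω ^ 2 * ∫ ω', Z k j ω' ^ 2 ∂P} :=
      (hZ k).measure_le_abs_transform_le (hY k) hδ.le hε
    _ ≤ ρ / 2 + ρ / 2 := by
      refine add_le_add hδρ ((measure_mono fun ω hω => ?_).trans hk)
      have hlt : δ < ∑ j, Y k j ω ^ 2 * ∫ ω', Z k j ω' ^ 2 ∂P := hω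
      exact hlt.le.trans (le_abs_self _)
    _ = ρ := ENNReal.add_halves ρ

end MartingaleTransform

section Gaussian

lemma integral_sq_gaussianReal (τ : ℝ≥0) : ∫ x, x ^ 2 ∂gaussianReal 0 τ = τ := by
  rw [← variance_fun_id_gaussianReal (μ := 0), variance_of_integral_eq_zero (by fun_prop) (by simp)]

lemma memLp_sq_gaussianReal (μ : ℝ) (τ : ℝ≥0) :
    MemLp (fun x : ℝ => x ^ 2) 2 (gaussianReal μ τ) := by
  rw [memLp_two_iff_integrable_sq (by fun_prop)]
  have h := (memLp_id_gaussianReal (μ := μ) (v := τ) 4).integrable_norm_pow (by norm_num)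
  simpa [← pow_mul, Even.pow_abs (show Even 4 by decide)] using h

lemma integral_sq_sub_gaussianReal (τ : ℝ≥0) : ∫ x, (x ^ 2 - τ) ∂gaussianReal 0 τ = 0 := by
  rw [integral_sub ((memLp_sq_gaussianReal 0 τ).integrable (by norm_num)) (integrable_const _),
    integral_sq_gaussianReal]
  simp

/-- The variance of the square of a standard Gaussian variable. -/
noncomputable def gaussianSquareVariance : ℝ := ∫ z, (z ^ 2 - 1) ^ 2 ∂gaussianReal 0 1

lemma integral_sq_sub_sq_gaussianReal (τ : ℝ≥0) :
    ∫ x, (x ^ 2 - τ) ^ 2 ∂gaussianReal 0 τ = gaussianSquareVariance * τ ^ 2 := by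
  have hscale : gaussianReal 0 τ = (gaussianReal 0 1).map (√(τ : ℝ) * ·) := by
    rw [gaussianReal_map_const_mul]
    congr 1
    · simp
    · ext; simp
  rw [hscale, integral_map (by fun_prop) (by fun_prop), gaussianSquareVariance,
    ← integral_mul_const]
  refine integral_congr_ae (.of_forall fun z => ?_)
  simp only [mul_pow, Real.sq_sqrt τ.coe_nonneg]
  ring

end Gaussian

/-- The filtration `𝓕` observed at the times `s j`. -/
def sampledFiltration {Ω ι κ : Type*} {mΩ : MeasurableSpace Ω} [Preorder ι] [Preorder κ]
    (𝓕 : Filtration κ mΩ) {s : ι → κ} (hs : Monotone s) : Filtration ι mΩ where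
  seq j := 𝓕 (s j)
  mono' _ _ hij := 𝓕.mono (hs hij)
  le' j := 𝓕.le (s j)

namespace IsFilteredBrownian

section Increments

variable {Ω : Type*} {mΩ : MeasurableSpace Ω} {P : Measure Ω} {𝓕 : Filtration ℝ≥0 mΩ}
  {W : ℝ≥0 → Ω → ℝ} (hW : IsFilteredBrownian W 𝓕 P)
include hW

lemma measurable (t : ℝ≥0) : Measurable (W t) :=
  (hW.adapted t).measurable.mono (𝓕.le t) le_rfl

lemma measurable_le {s t : ℝ≥0} (hst : s ≤ t) : Measurable[𝓕 t] (W s) :=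
  (hW.adapted s).measurable.mono (𝓕.mono hst) le_rfl

lemma hasLaw_increment {s t : ℝ≥0} (hst : s ≤ t) :
    HasLaw (fun ω => W t ω - W s ω) (gaussianReal 0 (t - s)) P := by
  have hdist : nndist t.1 s.1 = t - s := by
    ext
    rw [NNReal.coe_sub hst, coe_nndist, Real.dist_eq]
    exact abs_of_nonneg (sub_nonneg.2 (NNReal.coe_le_coe.2 hst))
  exact hdist ▸ hW.isBrownian.hasLaw_sub t s

lemma integral_sq_increment {s t : ℝ≥0} (hst : s ≤ t) :
    ∫ ω, (W t ω - W s ω) ^ 2 ∂P = t - s := by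
  rw [← NNReal.coe_sub hst, ← integral_sq_gaussianReal]
  exact (hW.hasLaw_increment hst).integral_comp (f := fun x => x ^ 2) (by fun_prop)

lemma integral_centred_sq_increment_sq {s t : ℝ≥0} (hst : s ≤ t) :
    ∫ ω, ((W t ω - W s ω) ^ 2 - (t - s)) ^ 2 ∂P = gaussianSquareVariance * (t - s : ℝ) ^ 2 := by
  rw [← NNReal.coe_sub hst, ← integral_sq_sub_sq_gaussianReal]
  exact (hW.hasLaw_increment hst).integral_comp
    (f := fun x => (x ^ 2 - (t - s : ℝ≥0)) ^ 2) (by fun_prop)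

variable {ι : Type*} [LinearOrder ι] {s r : ι → ℝ≥0} (hs : Monotone s) (hsr : ∀ j, s j ≤ r j)
  (hrs : ∀ i j, i < j → r i ≤ s j)
include hsr hrs

lemma isCentredNoise_comp_increment {g : ι → ℝ → ℝ} (hg : ∀ j, Measurable (g j))
    (hmem : ∀ j, MemLp (g j) 2 (gaussianReal 0 (r j - s j)))
    (hzero : ∀ j, ∫ x, g j x ∂gaussianReal 0 (r j - s j) = 0) :
    IsCentredNoise (fun j ω => g j (W (r j) ω - W (s j) ω)) (sampledFiltration 𝓕 hs) P where
  memLp j := by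
    have hlaw := hW.hasLaw_increment (hsr j)
    exact (hlaw.map_eq ▸ hmem j).comp_of_map hlaw.aemeasurable
  measurable_of_lt i j hij := (hg i).comp
    ((hW.measurable_le (hrs i j hij)).sub (hW.measurable_le ((hsr i).trans (hrs i j hij))))
  indep j := indep_of_indep_of_le_left (hW.indep _ _ (hsr j))
    ((hg j).comp (comap_measurable _)).comap_le
  integral_eq_zero j := by
    rw [← hzero j]
    exact (hW.hasLaw_increment (hsr j)).integral_comp (hg j).aestronglyMeasurable

lemma isCentredNoise_increment :
    IsCentredNoise (fun j ω => W (r j) ω - W (s j) ω) (sampledFiltration 𝓕 hs) P :=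
  hW.isCentredNoise_comp_increment hs hsr hrs (g := fun _ x => x) (fun _ => measurable_id)
    (fun _ => memLp_id_gaussianReal' 2 (by simp)) fun _ => integral_id_gaussianReal

lemma isCentredNoise_sq_increment :
    IsCentredNoise (fun j ω => (W (r j) ω - W (s j) ω) ^ 2 - (r j - s j : ℝ))
      (sampledFiltration 𝓕 hs) P := by
  simp_rw [← NNReal.coe_sub (hsr _)]
  exact hW.isCentredNoise_comp_increment hs hsr hrs
    (g := fun j x => x ^ 2 - (r j - s j : ℝ≥0)) (fun j => by fun_prop)
    (fun j => (memLp_sq_gaussianReal 0 _).sub (memLp_const _))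
    fun j => integral_sq_sub_gaussianReal _

end Increments

section WeightedSums

variable {Ω : Type*} {mΩ : MeasurableSpace Ω} {P : Measure Ω} [IsProbabilityMeasure P]
  {𝓕 : Filtration ℝ≥0 mΩ} {W : ℝ≥0 → Ω → ℝ} (hW : IsFilteredBrownian W 𝓕 P)
  {a b : ℝ≥0} {ψ : ℝ → ℝ} (hψ : Continuous ψ)
include hW hψ

lemma tendstoInMeasure_riemannSum :
    TendstoInMeasure P (fun (π : TimePartition a b) ω => ∑ j, ψ (W (π.left j) ω) * π.length j)
      (TimePartition.diamToZero a b) (fun ω => ∫ t in (a : ℝ)..b, ψ (W t.toNNReal ω)) := by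
  have hm := hW.measurable
  refine tendstoInMeasure_of_tendsto_ae_filter (fun π => by fun_prop) ?_
  filter_upwards [hW.isBrownian.cont] with ω hω
  exact TimePartition.tendsto_riemannSum (hψ.comp hω)

lemma tendstoInMeasure_sum_mul_length_zero {c : ∀ π : TimePartition a b, Fin π.n → Ω → ℝ}
    (hcm : ∀ π j, Measurable (c π j))
    (hc : ∀ᵐ ω ∂P, ∀ η > 0, ∀ᶠ π in TimePartition.diamToZero a b, ∀ j, |c π j ω| ≤ η) :
    TendstoInMeasure P (fun π ω => ∑ j, ψ (W (π.left j) ω) * c π j ω * π.length j)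
      (TimePartition.diamToZero a b) 0 := by
  have hm := hW.measurable
  refine tendstoInMeasure_of_tendsto_ae_filter (fun π => by fun_prop) ?_
  filter_upwards [hW.isBrownian.cont, hc] with ω hω hcω
  exact TimePartition.tendsto_sum_mul_length_zero (hψ.comp hω) hcω

variable {lam : ℝ≥0} (hlam : lam ≤ 1)
include hlam

lemma tendstoInMeasure_sum_mul_sq_increment_sub :
    TendstoInMeasure P (fun (π : TimePartition a b) ω => ∑ j, ψ (W (π.left j) ω) *
      ((W (π.tag lam j) ω - W (π.left j) ω) ^ 2 - (π.tag lam j - π.left j : ℝ)))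
      (TimePartition.diamToZero a b) 0 := by
  refine tendstoInMeasure_transform_zero
    (fun π => hW.isCentredNoise_sq_increment π.monotone_left (fun j => (π.tag_mem_Icc j hlam).1)
      fun i j hij => (π.tag_mem_Icc i hlam).2.trans (π.right_le_left hij))
    (fun π j => hψ.measurable.comp (hW.measurable_le le_rfl)) ?_
  refine (hW.tendstoInMeasure_sum_mul_length_zero (hψ.pow 2)
    (c := fun π j _ => gaussianSquareVariance * lam ^ 2 * π.length j) (fun _ _ => measurable_const)
    (.of_forall fun _ => TimePartition.eventually_abs_mul_length_le _)).congr_left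
    fun π => .of_forall fun ω => Finset.sum_congr rfl fun j _ => ?_
  rw [hW.integral_centred_sq_increment_sq (π.tag_mem_Icc j hlam).1, π.coe_tag j hlam,
    add_sub_cancel_left, Pi.pow_apply]
  ring

lemma tendstoInMeasure_sum_mul_sq_increment :
    TendstoInMeasure P (fun (π : TimePartition a b) ω =>
      ∑ j, ψ (W (π.left j) ω) * (W (π.tag lam j) ω - W (π.left j) ω) ^ 2)
      (TimePartition.diamToZero a b) (fun ω => lam * ∫ t in (a : ℝ)..b, ψ (W t.toNNReal ω)) := by
  refine (tendstoInMeasure_add (hW.tendstoInMeasure_sum_mul_sq_increment_sub hψ hlam)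
    (tendstoInMeasure_const_mul lam (hW.tendstoInMeasure_riemannSum hψ))).congr
    (fun π => .of_forall fun ω => ?_) (.of_forall fun ω => zero_add _)
  simp only [Finset.mul_sum, ← Finset.sum_add_distrib, π.coe_tag _ hlam]
  exact Finset.sum_congr rfl fun j _ => by ring

lemma tendstoInMeasure_sum_mul_increment_mul_increment :
    TendstoInMeasure P (fun (π : TimePartition a b) ω =>
      ∑ j, ψ (W (π.left j) ω) * (W (π.tag lam j) ω - W (π.left j) ω) *
        (W (π.right j) ω - W (π.tag lam j) ω))
      (TimePartition.diamToZero a b) 0 := by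
  have hm := hW.measurable
  refine tendstoInMeasure_transform_zero (fun π : TimePartition a b =>
    hW.isCentredNoise_increment (π.monotone_tag hlam) (fun j => (π.tag_mem_Icc j hlam).2)
      fun i j hij => (π.right_le_left hij).trans (π.tag_mem_Icc j hlam).1)
    (fun π j => ?_) ?_
  · have hle := (π.tag_mem_Icc j hlam).1
    exact (hψ.measurable.comp (hW.measurable_le hle)).mul
      ((hW.measurable_le le_rfl).sub (hW.measurable_le hle))
  have hlam' : 0 ≤ 1 - (lam : ℝ) := sub_nonneg.2 (NNReal.coe_le_one.2 hlam)
  refine (hW.tendstoInMeasure_sum_mul_length_zero (hψ.pow 2)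
    (c := fun π j ω => (W (π.tag lam j) ω - W (π.left j) ω) ^ 2 * (1 - lam))
    (fun π j => by fun_prop) ?_).congr_left
    fun π => .of_forall fun ω => Finset.sum_congr rfl fun j _ => ?_
  · filter_upwards [hW.isBrownian.cont] with ω hω η hη
    filter_upwards [TimePartition.eventually_dist_left_le hω.continuousOn (Real.sqrt_pos.2 hη)]
      with π hπ j
    have hosc := (Real.le_sqrt (abs_nonneg _) hη.le).1 (hπ j _ (π.tag_mem_Icc j hlam))
    rw [abs_of_nonneg (mul_nonneg (sq_nonneg _) hlam'), ← sq_abs]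
    exact (mul_le_of_le_one_right (sq_nonneg _) (sub_le_self 1 lam.coe_nonneg)).trans hosc
  · rw [hW.integral_sq_increment (π.tag_mem_Icc j hlam).2, π.coe_tag j hlam, Pi.pow_apply]
    simp only [TimePartition.length]
    ring

end WeightedSums

end IsFilteredBrownian

section Taylor

lemma abs_taylor_one_le {Φ φ : ℝ → ℝ} (hΦ : ∀ z, HasDerivAt Φ (φ z) z) {x y η : ℝ}
    (hη : ∀ z ∈ Set.uIcc x y, |φ z - φ x| ≤ η) :
    |Φ y - Φ x - φ x * (y - x)| ≤ η * |y - x| := by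
  have hderiv (z) (_ : z ∈ Set.uIcc x y) :
      HasDerivWithinAt (fun z => Φ z - φ x * z) (φ z - φ x) (Set.uIcc x y) z := by
    refine (((hΦ z).sub ((hasDerivAt_id z).const_mul (φ x))).congr_deriv ?_).hasDerivWithinAt
    rw [mul_one]
  have hmvt := (convex_uIcc x y).norm_image_sub_le_of_norm_hasDerivWithin_le hderiv hη
    Set.left_mem_uIcc Set.right_mem_uIcc
  refine (congrArg abs ?_).trans_le hmvt
  ring

lemma abs_taylor_two_le {F Φ φ : ℝ → ℝ} (hF : ∀ z, HasDerivAt F (Φ z) z)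
    (hΦ : ∀ z, HasDerivAt Φ (φ z) z) {x y η : ℝ} (hη : ∀ z ∈ Set.uIcc x y, |φ z - φ x| ≤ η) :
    |F y - F x - Φ x * (y - x) - 1 / 2 * (φ x * (y - x) ^ 2)| ≤ η * (y - x) ^ 2 := by
  have hderiv (z) (_ : z ∈ Set.uIcc x y) :
      HasDerivWithinAt (fun z => F z - Φ x * z - 1 / 2 * (φ x * (z - x) ^ 2))
        (Φ z - Φ x - φ x * (z - x)) (Set.uIcc x y) z := by
    have hsq := ((((hasDerivAt_id z).sub_const x).pow 2).const_mul (φ x)).const_mul (1 / 2 : ℝ)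
    refine ((((hF z).sub ((hasDerivAt_id z).const_mul (Φ x))).sub hsq).congr_deriv
      ?_).hasDerivWithinAt
    simp only [id, mul_one, Nat.cast_ofNat, Nat.add_one_sub_one, pow_one]
    ring
  have hbound (z) (hz : z ∈ Set.uIcc x y) : ‖Φ z - Φ x - φ x * (z - x)‖ ≤ η * |y - x| := by
    refine (abs_taylor_one_le hΦ fun w hw => hη w (Set.uIcc_subset_uIcc_left hz hw)).trans ?_
    exact mul_le_mul_of_nonneg_left (Set.abs_sub_left_of_mem_uIcc hz)
      ((abs_nonneg _).trans (hη x Set.left_mem_uIcc))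
  have hmvt := (convex_uIcc x y).norm_image_sub_le_of_norm_hasDerivWithin_le hderiv hbound
    Set.left_mem_uIcc Set.right_mem_uIcc
  rw [Real.norm_eq_abs (y - x), mul_assoc, abs_mul_abs_self, ← sq] at hmvt
  refine (congrArg abs ?_).trans_le hmvt
  ring

lemma forall_mem_uIcc_of_continuous {x : ℝ≥0 → ℝ} (hx : Continuous x) {s t : ℝ≥0} (hst : s ≤ t)
    {p : ℝ → Prop} (hp : ∀ u ∈ Set.Icc s t, p (x u)) : ∀ z ∈ Set.uIcc (x s) (x t), p z := by
  intro z hz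
  obtain ⟨u, hu, rfl⟩ := intermediate_value_uIcc hx.continuousOn hz
  exact hp u (Set.uIcc_of_le hst ▸ hu)

namespace TimePartition

variable {a b : ℝ≥0} {x : ℝ≥0 → ℝ} (hx : Continuous x) {Φ φ : ℝ → ℝ}
  (hΦ : ∀ z, HasDerivAt Φ (φ z) z) (hφ : Continuous φ)
include hx hΦ hφ

lemma isLittleO_sub_sum_mul_increment_sub_sum_mul_sq_increment {F : ℝ → ℝ}
    (hF : ∀ z, HasDerivAt F (Φ z) z) :
    (fun π : TimePartition a b => F (x b) - F (x a) -
      ∑ j, Φ (x (π.left j)) * (x (π.right j) - x (π.left j)) -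
      1 / 2 * ∑ j, φ (x (π.left j)) * (x (π.right j) - x (π.left j)) ^ 2)
      =o[diamToZero a b] fun π => ∑ j, (x (π.right j) - x (π.left j)) ^ 2 := by
  have htel (π : TimePartition a b) :
      F (x b) - F (x a) = ∑ j, (F (x (π.right j)) - F (x (π.left j))) := by
    rw [sum_succ_sub_castSucc fun i => F (x (π.pt i)), π.first, π.last]
  refine (isLittleO_sum_of_forall_norm_le (R := fun (π : TimePartition a b) j =>
    F (x (π.right j)) - F (x (π.left j)) - Φ (x (π.left j)) * (x (π.right j) - x (π.left j)) -
      1 / 2 * (φ (x (π.left j)) * (x (π.right j) - x (π.left j)) ^ 2)) fun η hη => ?_).congr_left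
    fun π => by simp only [htel π, Finset.mul_sum, Finset.sum_sub_distrib]
  filter_upwards [eventually_dist_left_le (hφ.comp hx).continuousOn hη] with π hπ j
  exact abs_taylor_two_le hF hΦ (forall_mem_uIcc_of_continuous hx (π.left_lt_right j).le (hπ j))

lemma isLittleO_sum_tag_increment_mul_increment {lam : ℝ≥0} (hlam : lam ≤ 1) :
    (fun π : TimePartition a b => ∑ j, (Φ (x (π.tag lam j)) - Φ (x (π.left j)) -
      φ (x (π.left j)) * (x (π.tag lam j) - x (π.left j))) * (x (π.right j) - x (π.left j)))
      =o[diamToZero a b] fun π =>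
        ∑ j, ((x (π.tag lam j) - x (π.left j)) ^ 2 + (x (π.right j) - x (π.left j)) ^ 2) := by
  refine isLittleO_sum_of_forall_norm_le fun η hη => ?_
  filter_upwards [eventually_dist_left_le (hφ.comp hx).continuousOn hη] with π hπ j
  obtain ⟨hleft, hright⟩ := π.tag_mem_Icc j hlam
  have htaylor := abs_taylor_one_le hΦ (forall_mem_uIcc_of_continuous hx hleft
    fun u hu => hπ j u ⟨hu.1, hu.2.trans hright⟩)
  set d := x (π.tag lam j) - x (π.left j)
  set e := x (π.right j) - x (π.left j)
  calc _ ≤ η * |d| * |e| := by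
        rw [Real.norm_eq_abs, abs_mul]
        exact mul_le_mul_of_nonneg_right htaylor (abs_nonneg e)
    _ ≤ η * (d ^ 2 + e ^ 2) := by
        rw [mul_assoc, ← sq_abs d, ← sq_abs e]
        refine mul_le_mul_of_nonneg_left ?_ hη.le
        nlinarith [two_mul_le_add_sq |d| |e|, mul_nonneg (abs_nonneg d) (abs_nonneg e)]

end TimePartition

end Taylor

section RiemannSums

variable {Ω : Type*} {mΩ : MeasurableSpace Ω} {P : Measure Ω} {𝓕 : Filtration ℝ≥0 mΩ}
  {W : ℝ≥0 → Ω → ℝ} {a b : ℝ≥0}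

/-- The Riemann sum `∑_j Φ(W_{t_j^*}) (W_{t_j} - W_{t_{j-1}})` with evaluation at the points
`t_j^* = lam * t_j + (1 - lam) * t_{j-1}`. -/
noncomputable def taggedSum (W : ℝ≥0 → Ω → ℝ) (Φ : ℝ → ℝ) (lam : ℝ≥0) (π : TimePartition a b)
    (ω : Ω) : ℝ :=
  ∑ j, Φ (W (π.tag lam j) ω) * (W (π.right j) ω - W (π.left j) ω)

/-- The value of `∫_a^b Φ(W_t) dW_t` predicted by Itô's formula for an antiderivative of `Φ`. -/
noncomputable def itoFormula (W : ℝ≥0 → Ω → ℝ) (Φ : ℝ → ℝ) (a b : ℝ≥0) (ω : Ω) : ℝ :=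
  (∫ x in W a ω..W b ω, Φ x) - 1 / 2 * ∫ t in (a : ℝ)..b, deriv Φ (W t.toNNReal ω)

variable {Φ : ℝ → ℝ}

lemma hasDerivAt_deriv_of_contDiff (hΦ : ContDiff ℝ 1 Φ) (z : ℝ) :
    HasDerivAt Φ (deriv Φ z) z :=
  (hΦ.differentiable one_ne_zero z).hasDerivAt

namespace IsFilteredBrownian

variable (hW : IsFilteredBrownian W 𝓕 P) (hΦ : ContDiff ℝ 1 Φ)
include hW

lemma measurable_taggedSum (hΦ : Continuous Φ) (lam : ℝ≥0) (π : TimePartition a b) :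
    Measurable (taggedSum W Φ lam π) :=
  Finset.measurable_fun_sum _ fun _ _ => (hΦ.measurable.comp (hW.measurable _)).mul
    ((hW.measurable _).sub (hW.measurable _))

variable [IsProbabilityMeasure P]

lemma tendstoInMeasure_sum_sq_increment {lam : ℝ≥0} (hlam : lam ≤ 1) :
    TendstoInMeasure P (fun (π : TimePartition a b) ω =>
      ∑ j, (W (π.tag lam j) ω - W (π.left j) ω) ^ 2)
      (TimePartition.diamToZero a b) (fun _ => lam * (b - a : ℝ)) := by
  simpa using hW.tendstoInMeasure_sum_mul_sq_increment (a := a) (b := b)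
    (continuous_const (y := (1 : ℝ))) hlam

include hΦ

lemma tendstoInMeasure_taggedSum_zero :
    TendstoInMeasure P (taggedSum W Φ 0) (TimePartition.diamToZero a b) (itoFormula W Φ a b) := by
  have hm := hW.measurable
  have hφ := hΦ.continuous_deriv_one
  have hF := fun z => (hΦ.continuous.integral_hasStrictDerivAt 0 z).hasDerivAt
  set F : ℝ → ℝ := fun y => ∫ x in (0 : ℝ)..y, Φ x
  have hFc : Continuous F := Differentiable.continuous fun z => (hF z).differentiableAt
  have hQ := hW.tendstoInMeasure_sum_sq_increment (a := a) (b := b) le_rfl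
  have hS := hW.tendstoInMeasure_sum_mul_sq_increment (a := a) (b := b) hφ le_rfl
  simp only [TimePartition.tag_one, NNReal.coe_one, one_mul] at hQ hS
  have hR : TendstoInMeasure P (fun (π : TimePartition a b) ω =>
      F (W b ω) - F (W a ω) - taggedSum W Φ 0 π ω - 1 / 2 *
        ∑ j, deriv Φ (W (π.left j) ω) * (W (π.right j) ω - W (π.left j) ω) ^ 2)
      (TimePartition.diamToZero a b) 0 := by
    refine tendstoInMeasure_of_isLittleO hQ (fun π => ?_) ?_
    · have := hW.measurable_taggedSum hΦ.continuous 0 π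
      fun_prop
    · filter_upwards [hW.isBrownian.cont] with ω hω
      simpa only [taggedSum, TimePartition.tag_zero, Pi.zero_apply, sub_zero] using
        TimePartition.isLittleO_sub_sum_mul_increment_sub_sum_mul_sq_increment hω
          (hasDerivAt_deriv_of_contDiff hΦ) hφ hF
  refine (tendstoInMeasure_add (tendstoInMeasure_const fun ω => F (W b ω) - F (W a ω))
    (tendstoInMeasure_add (tendstoInMeasure_const_mul (-1) hR)
      (tendstoInMeasure_const_mul (-(1 / 2)) hS))).congr
    (fun π => .of_forall fun ω => by ring) (.of_forall fun ω => ?_)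
  have hint (s t : ℝ) : IntervalIntegrable Φ volume s t := hΦ.continuous.intervalIntegrable s t
  simp only [itoFormula, F, intervalIntegral.integral_interval_sub_left (hint _ _) (hint _ _),
    Pi.zero_apply]
  ring

lemma tendstoInMeasure_sum_tag_increment_mul_increment {lam : ℝ≥0} (hlam : lam ≤ 1) :
    TendstoInMeasure P (fun (π : TimePartition a b) ω =>
      ∑ j, (Φ (W (π.tag lam j) ω) - Φ (W (π.left j) ω)) * (W (π.right j) ω - W (π.left j) ω))
      (TimePartition.diamToZero a b)
      (fun ω => lam * ∫ t in (a : ℝ)..b, deriv Φ (W t.toNNReal ω)) := by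
  have hm := hW.measurable
  have hΦc := hΦ.continuous
  have hφ := hΦ.continuous_deriv_one
  have hQ := tendstoInMeasure_add (hW.tendstoInMeasure_sum_sq_increment (a := a) (b := b) hlam)
    (hW.tendstoInMeasure_sum_sq_increment (a := a) (b := b) le_rfl)
  simp only [TimePartition.tag_one, ← Finset.sum_add_distrib] at hQ
  have hR : TendstoInMeasure P (fun (π : TimePartition a b) ω =>
      ∑ j, (Φ (W (π.tag lam j) ω) - Φ (W (π.left j) ω) -
        deriv Φ (W (π.left j) ω) * (W (π.tag lam j) ω - W (π.left j) ω)) *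
        (W (π.right j) ω - W (π.left j) ω)) (TimePartition.diamToZero a b) 0 := by
    refine tendstoInMeasure_of_isLittleO hQ (fun π => by fun_prop) ?_
    filter_upwards [hW.isBrownian.cont] with ω hω
    simpa only [Pi.zero_apply, sub_zero] using
      TimePartition.isLittleO_sum_tag_increment_mul_increment hω
        (hasDerivAt_deriv_of_contDiff hΦ) hφ hlam
  refine (tendstoInMeasure_add hR (tendstoInMeasure_add
    (hW.tendstoInMeasure_sum_mul_sq_increment hφ hlam)
    (hW.tendstoInMeasure_sum_mul_increment_mul_increment hφ hlam))).congr
    (fun π => .of_forall fun ω => ?_) (.of_forall fun ω => by simp)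
  simp only [← Finset.sum_add_distrib]
  exact Finset.sum_congr rfl fun j _ => by ring

lemma tendstoInMeasure_taggedSum {lam : ℝ≥0} (hlam : lam ≤ 1) :
    TendstoInMeasure P (taggedSum W Φ lam) (TimePartition.diamToZero a b) (fun ω =>
      itoFormula W Φ a b ω + lam * ∫ t in (a : ℝ)..b, deriv Φ (W t.toNNReal ω)) := by
  refine (tendstoInMeasure_add (hW.tendstoInMeasure_taggedSum_zero hΦ)
    (hW.tendstoInMeasure_sum_tag_increment_mul_increment hΦ hlam)).congr_left
    fun π => .of_forall fun ω => ?_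
  simp only [taggedSum, TimePartition.tag_zero, ← Finset.sum_add_distrib, ← add_mul,
    add_sub_cancel]

end IsFilteredBrownian

end RiemannSums

section StepFunctions

lemma preimage_toNNReal_Ioc (p q : ℝ≥0) :
    Real.toNNReal ⁻¹' Set.Ioc p q = Set.Ioc (p : ℝ) q := by
  ext t
  simp [Real.lt_toNNReal_iff_coe_lt, Real.toNNReal_le_iff_le_coe]

/-- The squared distance of `f` and `g` in `L²([a, b])`. -/
noncomputable def sqDistL2 (a b : ℝ≥0) (f g : ℝ≥0 → ℝ) : ℝ≥0∞ :=
  ∫⁻ t in Set.Icc (a : ℝ) b, ‖f t.toNNReal - g t.toNNReal‖ₑ ^ 2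

lemma sqDistL2_le_two_mul_add {a b : ℝ≥0} {f g h : ℝ≥0 → ℝ} (hg : Measurable g)
    (hh : Measurable h) : sqDistL2 a b f g ≤ 2 * (sqDistL2 a b f h + sqDistL2 a b g h) := by
  simp only [sqDistL2]
  rw [← lintegral_add_right _ (by fun_prop), ← lintegral_const_mul' _ _ ENNReal.ofNat_ne_top]
  refine lintegral_mono fun t => ?_
  simp only [enorm_sq_eq_ofReal_sq]
  rw [← ENNReal.ofReal_add (sq_nonneg _) (sq_nonneg _), ← ENNReal.ofReal_ofNat 2,
    ← ENNReal.ofReal_mul zero_le_two]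
  refine ENNReal.ofReal_le_ofReal ?_
  have := add_sq_le (a := f t.toNNReal - h t.toNNReal) (b := h t.toNNReal - g t.toNNReal)
  rwa [sub_add_sub_cancel, sub_sq_comm (h _)] at this

namespace TimePartition

variable {a b : ℝ≥0} (π π' : TimePartition a b)

/-- The step function with value `c j` on the interval `(t_{j-1}, t_j]`. -/
noncomputable def stepFun (c : Fin π.n → ℝ) (t : ℝ≥0) : ℝ :=
  ∑ j, (Set.Ioc (π.left j) (π.right j)).indicator (fun _ => c j) t

lemma measurable_stepFun (c : Fin π.n → ℝ) : Measurable (π.stepFun c) :=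
  Finset.measurable_fun_sum _ fun _ _ => measurable_const.indicator measurableSet_Ioc

variable {π π'} in
lemma stepFun_of_mem {c : Fin π.n → ℝ} {j : Fin π.n} {t : ℝ≥0}
    (ht : t ∈ Set.Ioc (π.left j) (π.right j)) : π.stepFun c t = c j := by
  rw [stepFun, Finset.sum_eq_single j (fun i _ hij => ?_) (by simp), Set.indicator_of_mem ht]
  exact Set.indicator_of_notMem (Set.disjoint_right.1 (π.pairwise_disjoint_Ioc hij) ht) _

lemma setLIntegral_Icc_eq_sum (f : ℝ → ℝ≥0∞) :
    ∫⁻ t in Set.Icc (a : ℝ) b, f t = ∑ j, ∫⁻ t in Set.Ioc (π.left j : ℝ) (π.right j), f t := by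
  rw [setLIntegral_congr Ioc_ae_eq_Icc.symm, ← preimage_toNNReal_Ioc, ← π.iUnion_Ioc,
    Set.preimage_iUnion, lintegral_iUnion (fun j => measurable_real_toNNReal measurableSet_Ioc)
    fun i j hij => (π.pairwise_disjoint_Ioc hij).preimage _, tsum_fintype]
  simp only [preimage_toNNReal_Ioc]

lemma sqDistL2_eq_ofReal_sum {f g : ℝ≥0 → ℝ} {d : Fin π.n → ℝ}
    (h : ∀ j, ∀ t ∈ Set.Ioc (π.left j) (π.right j), f t - g t = d j) :
    sqDistL2 a b f g = ENNReal.ofReal (∑ j, d j ^ 2 * π.length j) := by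
  rw [sqDistL2, π.setLIntegral_Icc_eq_sum, ENNReal.ofReal_sum_of_nonneg fun j _ =>
    mul_nonneg (sq_nonneg _) (π.length_nonneg j)]
  refine Finset.sum_congr rfl fun j _ => ?_
  rw [setLIntegral_congr_fun (g := fun _ => ‖d j‖ₑ ^ 2) measurableSet_Ioc fun t ht => ?_]
  · rw [setLIntegral_const, Real.volume_Ioc, enorm_sq_eq_ofReal_sq,
      ← ENNReal.ofReal_mul (sq_nonneg _), length]
  · simp only [h j _ (preimage_toNNReal_Ioc _ _ ▸ ht : t ∈ Real.toNNReal ⁻¹' _)]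

lemma tendsto_sqDistL2_stepFun_left {y : ℝ≥0 → ℝ} (hy : Continuous y) :
    Tendsto (fun π : TimePartition a b => sqDistL2 a b (π.stepFun fun j => y (π.left j)) y)
      (diamToZero a b) (𝓝 0) := by
  have hbound (η : ℝ) (hη : 0 < η) : ∀ᶠ π : TimePartition a b in diamToZero a b,
      sqDistL2 a b (π.stepFun fun j => y (π.left j)) y ≤ ENNReal.ofReal (η ^ 2 * (b - a)) := by
    filter_upwards [eventually_dist_left_le hy.continuousOn hη] with π hπ
    rw [sqDistL2, setLIntegral_congr Ioc_ae_eq_Icc.symm, ENNReal.ofReal_mul (sq_nonneg η),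
      ← Real.volume_Ioc, ← setLIntegral_const]
    refine setLIntegral_mono measurable_const fun t ht => ?_
    rw [← preimage_toNNReal_Ioc, ← π.iUnion_Ioc] at ht
    obtain ⟨j, hj⟩ := Set.mem_iUnion.1 ht
    rw [stepFun_of_mem hj, enorm_sq_eq_ofReal_sq, sub_sq_comm]
    exact ENNReal.ofReal_le_ofReal
      (sq_le_sq.2 ((hπ j _ (Set.Ioc_subset_Icc_self hj)).trans (le_abs_self η)))
  have hlim : Tendsto (fun η : ℝ => ENNReal.ofReal (η ^ 2 * (b - a))) (𝓝[>] 0) (𝓝 0) := by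
    have : Continuous fun η : ℝ => ENNReal.ofReal (η ^ 2 * (b - a)) :=
      ENNReal.continuous_ofReal.comp (by fun_prop)
    simpa using (this.tendsto 0).mono_left nhdsWithin_le_nhds
  refine ENNReal.tendsto_nhds_zero.2 fun ε hε => ?_
  obtain ⟨η, hηε, hη⟩ := ((hlim.eventually_lt_const hε).and self_mem_nhdsWithin).exists
  exact (hbound η hη).mono fun π hπ => hπ.trans hηε.le

lemma sum_indicator_mul_increment (x : ℝ≥0 → ℝ) {p q : ℝ≥0} (hp : p ∈ Set.range π.pt)
    (hq : q ∈ Set.range π.pt) (hpq : p ≤ q) :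
    ∑ k, (Set.Ioc p q).indicator 1 (π.right k) * (x (π.right k) - x (π.left k)) = x q - x p := by
  have hmin_last {r : ℝ≥0} (hr : r ∈ Set.range π.pt) : min r (π.pt (Fin.last _)) = r := by
    obtain ⟨i, rfl⟩ := hr
    exact min_eq_left (π.strictMono.monotone (Fin.le_last i))
  have hmin_zero {r : ℝ≥0} (hr : r ∈ Set.range π.pt) : min r (π.pt 0) = π.pt 0 := by
    obtain ⟨i, rfl⟩ := hr
    exact min_eq_right (π.strictMono.monotone (Fin.zero_le i))
  have htel := sum_succ_sub_castSucc fun i => x (min q (π.pt i)) - x (min p (π.pt i))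
  simp only [hmin_last hp, hmin_last hq, hmin_zero hp, hmin_zero hq, sub_self, sub_zero] at htel
  refine (Finset.sum_congr rfl fun k _ => ?_).trans htel
  have hk := π.left_lt_right k
  rcases π.le_left_or_right_le k hp with hpk | hpk
  · rcases π.le_left_or_right_le k hq with hqk | hqk
    · simp [hpk, hqk, hpk.trans hk.le, hqk.trans hk.le, hqk.trans_lt hk]
    · simp [hpk, hqk, hpk.trans hk.le, hk.le.trans hqk, hpk.trans_lt hk]
  · simp [hpk, hpk.trans hpq, hk.le.trans hpk, hk.le.trans (hpk.trans hpq)]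

namespace Refines

variable {π π'} (h : π'.Refines π)
include h

lemma exists_le_left_right_le (k : Fin π'.n) :
    ∃ j, π.left j ≤ π'.left k ∧ π'.right k ≤ π.right j := by
  have hk : π'.right k ∈ Set.Ioc a b :=
    ⟨(π'.pt_mem_Icc _).1.trans_lt (π'.left_lt_right k), (π'.pt_mem_Icc _).2⟩
  rw [← π.iUnion_Ioc] at hk
  obtain ⟨j, hj⟩ := Set.mem_iUnion.1 hk
  exact ⟨j, (π'.le_left_or_right_le k (h ⟨_, rfl⟩)).resolve_right hj.1.not_ge, hj.2⟩

lemma stepFun_eq (c : Fin π.n → ℝ) (k : Fin π'.n) {t : ℝ≥0}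
    (ht : t ∈ Set.Ioc (π'.left k) (π'.right k)) :
    π.stepFun c t = π.stepFun c (π'.right k) := by
  obtain ⟨j, hleft, hright⟩ := h.exists_le_left_right_le k
  rw [stepFun_of_mem ⟨hleft.trans_lt ht.1, ht.2.trans hright⟩,
    stepFun_of_mem ⟨hleft.trans_lt (π'.left_lt_right k), hright⟩]

lemma sum_stepFun_mul_increment (c : Fin π.n → ℝ) (x : ℝ≥0 → ℝ) :
    ∑ k, π.stepFun c (π'.right k) * (x (π'.right k) - x (π'.left k)) =
      ∑ j, c j * (x (π.right j) - x (π.left j)) := by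
  simp only [stepFun, Finset.sum_mul]
  rw [Finset.sum_comm]
  refine Finset.sum_congr rfl fun j _ => ?_
  rw [← π'.sum_indicator_mul_increment x (h ⟨_, rfl⟩) (h ⟨_, rfl⟩) (π.left_lt_right j).le,
    Finset.mul_sum]
  refine Finset.sum_congr rfl fun k _ => ?_
  simp [Set.indicator_apply]

lemma ofReal_sum_sq_le {y : ℝ≥0 → ℝ} (hy : Measurable y) (c : Fin π.n → ℝ) :
    ENNReal.ofReal (∑ k, (π.stepFun c (π'.right k) - y (π'.left k)) ^ 2 * π'.length k) ≤
      2 * (sqDistL2 a b (π.stepFun c) y +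
        sqDistL2 a b (π'.stepFun fun k => y (π'.left k)) y) := by
  rw [← π'.sqDistL2_eq_ofReal_sum (f := π.stepFun c) (g := π'.stepFun fun k => y (π'.left k))
    fun k t ht => by rw [h.stepFun_eq c k ht, stepFun_of_mem ht]]
  exact sqDistL2_le_two_mul_add (π'.measurable_stepFun _) hy

end Refines

end TimePartition

end StepFunctions

section SimpleApproximation

variable {Ω : Type*} {mΩ : MeasurableSpace Ω} {P : Measure Ω} {𝓕 : Filtration ℝ≥0 mΩ}
  {f : ℝ≥0 → Ω → ℝ} {a b : ℝ≥0}

lemma exists_measurable_uncurry_ae_eq (hf : ∀ t, Measurable (f t))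
    (hcont : ∀ᵐ ω ∂P, Continuous (f · ω)) :
    ∃ g : ℝ≥0 → Ω → ℝ, Measurable (Function.uncurry g) ∧ ∀ᵐ ω ∂P, (f · ω) = (g · ω) := by
  obtain ⟨A, hA, hAm, hAc⟩ := Eventually.exists_measurable_mem hcont
  refine ⟨fun t => A.indicator (f t), measurable_uncurry_of_continuous_of_measurable (fun ω => ?_)
    fun t => (hf t).indicator hAm, ?_⟩
  · by_cases hω : ω ∈ A
    · simpa [hω] using hAc ω hω
    · simpa [hω] using continuous_const
  · filter_upwards [hA] with ω hω
    simp [hω]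

lemma TimePartition.aemeasurable_sqDistL2_stepFun (π : TimePartition a b) {Y : Fin π.n → Ω → ℝ}
    (hY : ∀ j, Measurable (Y j)) (hf : ∀ t, Measurable (f t))
    (hcont : ∀ᵐ ω ∂P, Continuous (f · ω)) :
    AEMeasurable (fun ω => sqDistL2 a b (π.stepFun fun j => Y j ω) (f · ω)) P := by
  obtain ⟨g, hg, hfg⟩ := exists_measurable_uncurry_ae_eq hf hcont
  have hstep : Measurable fun p : Ω × ℝ => π.stepFun (fun j => Y j p.1) p.2.toNNReal :=
    Finset.measurable_fun_sum _ fun j _ => ((hY j).comp measurable_fst).indicator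
      (s := {p : Ω × ℝ | p.2.toNNReal ∈ Set.Ioc (π.left j) (π.right j)})
      (measurable_snd.real_toNNReal measurableSet_Ioc)
  have hgm : Measurable fun p : Ω × ℝ => g p.2.toNNReal p.1 :=
    hg.comp (measurable_snd.real_toNNReal.prodMk measurable_fst)
  refine ⟨fun ω => sqDistL2 a b (π.stepFun fun j => Y j ω) (g · ω),
    Measurable.lintegral_prod_right' (hstep.sub hgm |>.enorm.pow_const 2), ?_⟩
  filter_upwards [hfg] with ω hω
  rw [hω]

lemma tendstoInMeasure_sqDistL2_stepFun_left [IsFiniteMeasure P] (hf : ∀ t, Measurable (f t))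
    (hcont : ∀ᵐ ω ∂P, Continuous (f · ω)) {u : ℕ → TimePartition a b}
    (hu : Tendsto u atTop (TimePartition.diamToZero a b)) :
    TendstoInMeasure P
      (fun n ω => sqDistL2 a b ((u n).stepFun fun k => f ((u n).left k) ω) (f · ω)) atTop 0 := by
  refine tendstoInMeasure_zero_of_tendsto_ae
    (fun n => (u n).aemeasurable_sqDistL2_stepFun (fun k => hf _) hf hcont) ?_
  filter_upwards [hcont] with ω hω
  exact (TimePartition.tendsto_sqDistL2_stepFun_left hω).comp hu

namespace ItoSimpleProcess

lemma measurable_val_right (H : ItoSimpleProcess 𝓕 a b) {π : TimePartition a b}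
    (hπ : π.Refines H.toTimePartition) (k : Fin π.n) :
    Measurable[𝓕 (π.left k)] (H.val (π.right k)) := by
  obtain ⟨j, hleft, hright⟩ := hπ.exists_le_left_right_le k
  have hval : H.val (π.right k) = H.ξ j := funext fun ω =>
    TimePartition.stepFun_of_mem ⟨hleft.trans_lt (π.left_lt_right k), hright⟩
  rw [hval]
  exact (H.measurable_ξ j).mono (𝓕.mono hleft) le_rfl

/-- The simple process with values `f (t_{j-1})`, truncated to `[-n, n]`, on `(t_{j-1}, t_j]`. -/
noncomputable def truncated (hf : StronglyAdapted 𝓕 f) (π : TimePartition a b) (n : ℕ) :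
    ItoSimpleProcess 𝓕 a b where
  toTimePartition := π
  ξ j ω := max (-n) (min n (f (π.left j) ω))
  measurable_ξ _ := measurable_const.max (measurable_const.min (hf _).measurable)
  bounded_ξ _ := ⟨n, fun _ => abs_le.2 ⟨le_max_left _ _,
    max_le (neg_le_self n.cast_nonneg) (min_le_left _ _)⟩⟩

lemma eventually_truncated_ξ_eq (hf : StronglyAdapted 𝓕 f) (u : ℕ → TimePartition a b) {ω : Ω}
    (hω : Continuous (f · ω)) :
    ∀ᶠ n in atTop, ∀ j, (truncated hf (u n) n).ξ j ω = f ((u n).left j) ω := by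
  obtain ⟨M, hM⟩ := isCompact_Icc.exists_bound_of_continuousOn (s := Set.Icc a b) hω.continuousOn
  filter_upwards [eventually_ge_atTop ⌈M⌉₊] with n hn j
  obtain ⟨hlow, hup⟩ := abs_le.1 ((hM _ ((u n).pt_mem_Icc j.castSucc)).trans (Nat.ceil_le.1 hn))
  exact (congrArg _ (min_eq_right hup)).trans (max_eq_right hlow)

lemma tendstoInMeasure_sqDistL2_truncated [IsFiniteMeasure P] (hf : StronglyAdapted 𝓕 f)
    (hcont : ∀ᵐ ω ∂P, Continuous (f · ω)) {u : ℕ → TimePartition a b}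
    (hu : Tendsto u atTop (TimePartition.diamToZero a b)) :
    TendstoInMeasure P (fun n ω => sqDistL2 a b ((truncated hf (u n) n).val · ω) (f · ω))
      atTop 0 := by
  have hfm (t) : Measurable (f t) := (hf t).measurable.mono (𝓕.le t) le_rfl
  have hξm (n j) : Measurable ((truncated hf (u n) n).ξ j) :=
    ((truncated hf (u n) n).measurable_ξ j).mono (𝓕.le _) le_rfl
  refine tendstoInMeasure_zero_of_tendsto_ae
    (fun n => (u n).aemeasurable_sqDistL2_stepFun (hξm n) hfm hcont) ?_
  filter_upwards [hcont] with ω hω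
  refine ((TimePartition.tendsto_sqDistL2_stepFun_left hω).comp hu).congr' ?_
  filter_upwards [eventually_truncated_ξ_eq hf u hω] with n hn
  exact congrArg (fun c => sqDistL2 a b ((u n).stepFun c) (f · ω)) (funext hn).symm

/- On a common refinement, both sums are transforms of the same increments, and the bracket of their
difference is controlled by the `L²` distances of `H n` and of the left point sampling from `f`. -/
lemma tendstoInMeasure_integral_sub_sum_left [IsProbabilityMeasure P] {W : ℝ≥0 → Ω → ℝ}
    (hW : IsFilteredBrownian W 𝓕 P) (hf : StronglyAdapted 𝓕 f)
    (hcont : ∀ᵐ ω ∂P, Continuous (f · ω)) {H : ℕ → ItoSimpleProcess 𝓕 a b}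
    (hH : TendstoInMeasure P (fun n ω => sqDistL2 a b ((H n).val · ω) (f · ω)) atTop 0)
    {u : ℕ → TimePartition a b} (hrefines : ∀ n, (u n).Refines (H n).toTimePartition)
    (hu : Tendsto u atTop (TimePartition.diamToZero a b)) :
    TendstoInMeasure P (fun n ω => (H n).integral W ω -
      ∑ k, f ((u n).left k) ω * (W ((u n).right k) ω - W ((u n).left k) ω)) atTop 0 := by
  have hfm (t) : Measurable (f t) := (hf t).measurable.mono (𝓕.le t) le_rfl
  have htransform : TendstoInMeasure P (fun n ω => ∑ k, ((H n).val ((u n).right k) ω -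
      f ((u n).left k) ω) * (W ((u n).right k) ω - W ((u n).left k) ω)) atTop 0 := by
    refine tendstoInMeasure_transform_zero (fun n => hW.isCentredNoise_increment
      (u n).monotone_left (fun k => ((u n).left_lt_right k).le)
      fun i j hij => (u n).right_le_left hij)
      (fun n k => ((H n).measurable_val_right (hrefines n) k).sub (hf _).measurable)
      (tendstoInMeasure_of_edist_le_const_mul_add (C := 2) hH
        (tendstoInMeasure_sqDistL2_stepFun_left hfm hcont hu) fun n => ?_)
    filter_upwards [hcont] with ω hω
    have hbracket (k) : ∫ ω', (W ((u n).right k) ω' - W ((u n).left k) ω') ^ 2 ∂P =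
        (u n).length k := hW.integral_sq_increment ((u n).left_lt_right k).le
    simp only [hbracket, Pi.zero_apply, edist_zero_right]
    rw [Real.enorm_of_nonneg (Finset.sum_nonneg fun k _ =>
      mul_nonneg (sq_nonneg _) ((u n).length_nonneg k))]
    exact (hrefines n).ofReal_sum_sq_le hω.measurable fun j => (H n).ξ j ω
  refine htransform.congr_left fun n => .of_forall fun ω => ?_
  simp only [sub_mul, Finset.sum_sub_distrib]
  exact congrArg (· - _) ((hrefines n).sum_stepFun_mul_increment (fun j => (H n).ξ j ω) (W · ω))

end ItoSimpleProcess

end SimpleApproximation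

section MainTheorem

variable {Ω : Type*} {mΩ : MeasurableSpace Ω} {P : Measure Ω} {𝓕 : Filtration ℝ≥0 mΩ}
  {W : ℝ≥0 → Ω → ℝ} {a b : ℝ≥0} {Φ : ℝ → ℝ}

/-- `S` is (a version of) the limit in probability of `taggedSum W Φ lam` as the diameter of the
partition tends to zero. The Itô, Stratonovich and Fehlberg integrals are the cases `lam = 0`,
`lam = 1 / 2` and `lam = 255 / 512`. -/
def IsTaggedIntegral (P : Measure Ω) (W : ℝ≥0 → Ω → ℝ) (Φ : ℝ → ℝ) (lam a b : ℝ≥0) (S : Ω → ℝ) :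
    Prop :=
  AEMeasurable S P ∧
    TendstoInMeasure P (fun π : TimePartition a b => taggedSum W Φ lam π)
      (TimePartition.diamToZero a b) S

lemma isFehlbergIntegral_iff_isTaggedIntegral {S : Ω → ℝ} :
    IsFehlbergIntegral P W Φ a b S ↔ IsTaggedIntegral P W Φ (255 / 512) a b S :=
  Iff.rfl

lemma memLp_two_restrict_Icc_of_continuous {f : ℝ → ℝ} (hf : Continuous f) (s t : ℝ) :
    MemLp f 2 (volume.restrict (Set.Icc s t)) := by
  obtain ⟨M, hM⟩ := isCompact_Icc.exists_bound_of_continuousOn (s := Set.Icc s t) hf.continuousOn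
  exact MemLp.of_bound hf.aestronglyMeasurable M
    ((ae_restrict_iff' measurableSet_Icc).2 (.of_forall hM))

namespace IsFilteredBrownian

variable [IsProbabilityMeasure P] (hW : IsFilteredBrownian W 𝓕 P) (hab : a ≤ b)
  (hΦ : ContDiff ℝ 1 Φ)
include hW hΦ

lemma tendstoInMeasure_integral_itoFormula {H : ℕ → ItoSimpleProcess 𝓕 a b}
    (hH : TendstoInMeasure P (fun n ω => sqDistL2 a b ((H n).val · ω) (fun t => Φ (W t ω)))
      atTop 0) :
    TendstoInMeasure P (fun n => (H n).integral W) atTop (itoFormula W Φ a b) := by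
  obtain ⟨u, hrefines, hu⟩ :=
    TimePartition.exists_seq_refines fun n => (H n).toTimePartition
  have hdiff := ItoSimpleProcess.tendstoInMeasure_integral_sub_sum_left hW
    (fun t => hΦ.continuous.comp_stronglyMeasurable (hW.adapted t))
    (hW.isBrownian.cont.mono fun ω hω => hΦ.continuous.comp hω) hH hrefines hu
  refine (tendstoInMeasure_add hdiff ((hW.tendstoInMeasure_taggedSum_zero hΦ).comp hu)).congr
    (fun n => .of_forall fun ω => ?_) (.of_forall fun ω => zero_add _)
  simp only [Function.comp_apply, taggedSum, TimePartition.tag_zero, sub_add_cancel]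

lemma ae_eq_itoFormula {I : Ω → ℝ} (hI : IsItoIntegral P 𝓕 W (fun t ω => Φ (W t ω)) a b I) :
    I =ᵐ[P] itoFormula W Φ a b := by
  obtain ⟨-, -, -, H, hH, hlim⟩ := hI
  refine tendstoInMeasure_ae_unique hlim (hW.tendstoInMeasure_integral_itoFormula hΦ ?_)
  simpa only [TendstoInMeasure, Pi.zero_apply, edist_zero_right_ennreal, sqDistL2] using hH

include hab

lemma isTaggedIntegral {lam : ℝ≥0} (hlam : lam ≤ 1) :
    IsTaggedIntegral P W Φ lam a b (fun ω =>
      itoFormula W Φ a b ω + lam * ∫ t in (a : ℝ)..b, deriv Φ (W t.toNNReal ω)) := by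
  have := TimePartition.diamToZero_neBot hab
  have hlim := hW.tendstoInMeasure_taggedSum (a := a) (b := b) hΦ hlam
  exact ⟨hlim.aemeasurable fun π =>
    (hW.measurable_taggedSum hΦ.continuous lam π).aemeasurable, hlim⟩

lemma isItoIntegral_itoFormula :
    IsItoIntegral P 𝓕 W (fun t ω => Φ (W t ω)) a b (itoFormula W Φ a b) := by
  have hf : StronglyAdapted 𝓕 fun t ω => Φ (W t ω) := fun t =>
    hΦ.continuous.comp_stronglyMeasurable (hW.adapted t)
  have hcont : ∀ᵐ ω ∂P, Continuous fun t => Φ (W t ω) :=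
    hW.isBrownian.cont.mono fun ω hω => hΦ.continuous.comp hω
  have := TimePartition.diamToZero_neBot hab
  obtain ⟨u, hu⟩ := (TimePartition.diamToZero a b).exists_seq_tendsto
  have hH := ItoSimpleProcess.tendstoInMeasure_sqDistL2_truncated hf hcont hu
  have hmeas : AEMeasurable (itoFormula W Φ a b) P := by
    simpa using (hW.isTaggedIntegral hab hΦ (zero_le_one (α := ℝ≥0))).1
  refine ⟨hmeas, hf, ?_, fun n => .truncated hf (u n) n, ?_,
    hW.tendstoInMeasure_integral_itoFormula hΦ hH⟩
  · filter_upwards [hcont] with ω hω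
    exact memLp_two_restrict_Icc_of_continuous (hω.comp continuous_real_toNNReal) a b
  · simpa only [TendstoInMeasure, Pi.zero_apply, edist_zero_right_ennreal, sqDistL2] using hH

end IsFilteredBrownian

theorem theorem6p2_general [IsProbabilityMeasure P] (hW : IsFilteredBrownian W 𝓕 P)
    (hab : a ≤ b) (hΦ : ContDiff ℝ 1 Φ) {lam : ℝ≥0} (hlam : lam ≤ 1) :
    (∃ S : Ω → ℝ, IsTaggedIntegral P W Φ lam a b S) ∧
    (∃ I : Ω → ℝ, IsItoIntegral P 𝓕 W (fun t ω => Φ (W t ω)) a b I) ∧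
    (∀ᵐ ω ∂P, IntervalIntegrable (fun t : ℝ => deriv Φ (W t.toNNReal ω)) volume a b) ∧
    ∀ S I : Ω → ℝ, IsTaggedIntegral P W Φ lam a b S →
      IsItoIntegral P 𝓕 W (fun t ω => Φ (W t ω)) a b I →
      ∀ᵐ ω ∂P, S ω = I ω + lam * ∫ t in (a : ℝ)..(b : ℝ), deriv Φ (W t.toNNReal ω) := by
  have := TimePartition.diamToZero_neBot hab
  refine ⟨⟨_, hW.isTaggedIntegral hab hΦ hlam⟩, ⟨_, hW.isItoIntegral_itoFormula hab hΦ⟩, ?_,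
    fun S I hS hI => ?_⟩
  · filter_upwards [hW.isBrownian.cont] with ω hω
    exact (hΦ.continuous_deriv_one.comp (hω.comp continuous_real_toNNReal)).intervalIntegrable _ _
  · filter_upwards [tendstoInMeasure_ae_unique hS.2 (hW.isTaggedIntegral hab hΦ hlam).2,
      hW.ae_eq_itoFormula hΦ hI] with ω hSω hIω
    rw [hSω, hIω]

end MainTheorem

theorem theorem6p2 {Ω : Type*} {mΩ : MeasurableSpace Ω} (P : Measure Ω) [IsProbabilityMeasure P]
    (𝓕 : Filtration ℝ≥0 mΩ) (W : ℝ≥0 → Ω → ℝ) (hW : IsFilteredBrownian W 𝓕 P)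
    (a b : ℝ≥0) (hab : a < b) (Φ : ℝ → ℝ) (hΦ : ContDiff ℝ 1 Φ) :
    (∃ S : Ω → ℝ, IsFehlbergIntegral P W Φ a b S) ∧
    (∃ I : Ω → ℝ, IsItoIntegral P 𝓕 W (fun t ω => Φ (W t ω)) a b I) ∧
    (∀ᵐ ω ∂P, IntervalIntegrable (fun t : ℝ => deriv Φ (W t.toNNReal ω)) volume a b) ∧
    ∀ S I : Ω → ℝ, IsFehlbergIntegral P W Φ a b S →
      IsItoIntegral P 𝓕 W (fun t ω => Φ (W t ω)) a b I →
      ∀ᵐ ω ∂P, S ω = I ω +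
        (255 / 512 : ℝ) * ∫ t in (a : ℝ)..(b : ℝ), deriv Φ (W t.toNNReal ω) := by
  simpa [isFehlbergIntegral_iff_isTaggedIntegral] using theorem6p2_general hW hab.le hΦ
    (lam := 255 / 512) (div_le_one_of_le₀ (by norm_num) zero_le)
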